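/- Consider the linear model $y = X\beta^* + \epsilon$ with a deterministic design matrix $X\in\mathbb{R}^{n\times p}$, $n\ge 2$, with rows $X_1^\top,\dots,X_n^\top$, a vector $\beta^*\in\mathbb{R}^p$ and random errors $\epsilon=(\epsilon_1,\dots,\epsilon_n)$. Let $\mathcal{G}_1,\dots,\mathcal{G}_g$ be a partition of $\{1,\dots,p\}$, let $w_1,\dots,w_g>0$, and let $\Psi(\beta)=\sum_{l=1}^g w_l\|\beta_{\mathcal{G}_l}\|_2$, with dual norm $\Psi^d(y)=\sup_{\Psi(x)\le 1}\langle x,y\rangle$. For $\lambda>0$, a group lasso regularized rank regression estimator $\hat\beta(\lambda)$ is a minimizer over $\beta\in\mathbb{R}^p$ of $$\frac{1}{n(n-1)}\sum_{i=1}^n\sum_{j\ne i}\bigl|(X\beta-y)_i-(X\beta-y)_j\bigr|+\lambda\Psi(\beta).$$ Let $c_0>1$ and $0<\alpha_0<1$. Let $\lambda^*=c_0\,Q_{\Psi^d(S_n)}(1-\alpha_0)$, where $S_n=-\frac{2}{n(n-1)}X^\top\xi$, $\xi=2r-(n+1)$ (coordinatewise) with $r$ uniformly distributed over the permutations of $(1,\dots,n)$,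 and $Q_Z(u)=\inf\{t:\Pr(Z\le t)\ge u\}$. Suppose that $\lambda^*>0$. Put $\mathcal{A}_0=\{l:\beta^*_j\ne 0\text{ for some }j\in\mathcal{G}_l\}$ and $\Omega=\bigcup_{l\in\mathcal{A}_0}\mathcal{G}_l$. Let $\Psi_\Omega(\gamma)$ and $\Psi_{\bar\Omega}(\gamma)$ be the values of $\Psi$ at the vectors obtained from $\gamma$ by setting to zero the coordinates outside $\Omega$ and inside $\Omega$, respectively. Put $$c_{|\Omega|}=\Bigl(\sum_{l\in\mathcal{A}_0}w_l^2\Bigr)^{1/2},\quad c_p=\max_{1\le l\le g}w_l^{-1}\sqrt{|\mathcal{G}_l|},\quad \bar c=1+\frac{c_0+1}{c_0-1},\quad \mathcal{E}(n,p)=\frac{\log p}{n}+\sqrt{\frac{\log p}{n}}.$$ Assume that there are constants $b_1,b_2,b_3>0$ such that: 1. $\sum_{i=1}^n X_i=0$; $|X_{ij}|\le b_1$ for all $i,j$; and $\dfrac{\gamma^\top X^\top X\gamma}{n\|\gamma\|_2^2}\ge b_2$ for every $\gamma\ne 0$ in $\mathbb{R}^p$ with $\Psi_{\bar\Omega}(\gamma)\le(\bar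 c-1)\Psi_\Omega(\gamma)$. 2. $\epsilon_1,\dots,\epsilon_n$ are i.i.d. with a density $f$, and the differences $\epsilon_i-\epsilon_j$ ($i\ne j$) have a density $f^*$ with $f^*(\zeta)\ge b_3$ for all $|\zeta|\le\dfrac{68\,b_1^2c_0\bar c^2}{b_2b_3}\,c_p^2\,c_{|\Omega|}^2\,\mathcal{E}(n,p)$. If $p\ge 2/\alpha_0$, then every group lasso regularized rank regression estimator $\hat\beta(\lambda^*)$ satisfies $$\|\hat\beta(\lambda^*)-\beta^*\|_2\le\frac{34\,b_1c_0\bar c}{b_2b_3}\,c_{|\Omega|}\,c_p\,\mathcal{E}(n,p)$$ with probability at least $1-\exp\bigl(-n\,\mathcal{E}(n,p)^2\bigr)-\alpha_0$. -/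

import Mathlib

open MeasureTheory ProbabilityTheory
open scoped Matrix

namespace RankLasso

/-- A partition of the coordinate set `{1, …, p}` into `g` groups, with positive weights. -/
structure WeightedGroups (p g : ℕ) where
  /-- the groups -/
  G : Fin g → Finset (Fin p)
  /-- the weights -/
  w : Fin g → ℝ
  disjoint : Pairwise fun k l => Disjoint (G k) (G l)
  cover : ∀ j, ∃ l, j ∈ G l
  w_pos : ∀ l, 0 < w l

noncomputable section

variable {n p g : ℕ}

/-- The group lasso regularizer `Ψ(β) = ∑ₗ wₗ ‖β_{Gₗ}‖₂`. -/
def Psi (𝓖 : WeightedGroups p g) (β : EuclideanSpace ℝ (Fin p)) : ℝ :=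
  ∑ l, 𝓖.w l * Real.sqrt (∑ j ∈ 𝓖.G l, β j ^ 2)

/-- The dual norm `Ψᵈ(y) = sup {⟨x, y⟩ : Ψ(x) ≤ 1}`. -/
def dualPsi (𝓖 : WeightedGroups p g) (y : EuclideanSpace ℝ (Fin p)) : ℝ :=
  sSup {s : ℝ | ∃ x : EuclideanSpace ℝ (Fin p), Psi 𝓖 x ≤ 1 ∧ s = inner ℝ x y}

/-- The Wilcoxon rank loss `L(z) = (n(n-1))⁻¹ ∑ᵢ ∑_{j ≠ i} |zᵢ - zⱼ|`. -/
def rankLoss (z : Fin n → ℝ) : ℝ :=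
  1 / ((n : ℝ) * ((n : ℝ) - 1)) * ∑ i, ∑ j ∈ Finset.univ.erase i, |z i - z j|

/-- `b` is a group lasso regularized rank regression estimator with data `(X, y)` and parameter
`lam`: a minimizer of `β ↦ L(Xβ - y) + lam Ψ(β)` over `ℝᵖ`. -/
def IsEstimator (𝓖 : WeightedGroups p g) (X : Matrix (Fin n) (Fin p) ℝ) (y : Fin n → ℝ)
    (lam : ℝ) (b : EuclideanSpace ℝ (Fin p)) : Prop :=
  IsMinOn (fun β : EuclideanSpace ℝ (Fin p) => rankLoss (X *ᵥ β.ofLp - y) + lam * Psi 𝓖 β)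
    Set.univ b

/-- The vector `ξ = 2r - (n+1)`, where the ranks `r` run over `{1, …, n}`. -/
def xi (σ : Equiv.Perm (Fin n)) : Fin n → ℝ :=
  fun i => 2 * (((σ i : ℕ) : ℝ) + 1) - ((n : ℝ) + 1)

/-- The vector `Sₙ = -(2 / (n(n-1))) Xᵀ ξ` for the rank permutation `σ`. -/
def Sn (X : Matrix (Fin n) (Fin p) ℝ) (σ : Equiv.Perm (Fin n)) : EuclideanSpace ℝ (Fin p) :=
  WithLp.toLp 2 ((-(2 / ((n : ℝ) * ((n : ℝ) - 1)))) • (Xᵀ *ᵥ xi σ))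

/-- The `u`-quantile of `Z(σ)`, with `σ` uniformly distributed over the permutations of
`{1, …, n}`: the least `t` with `pr(Z ≤ t) ≥ u`. -/
def permQuantile (Z : Equiv.Perm (Fin n) → ℝ) (u : ℝ) : ℝ :=
  sInf {t : ℝ | u ≤ (Nat.card {σ : Equiv.Perm (Fin n) // Z σ ≤ t} : ℝ) /
    (Nat.card (Equiv.Perm (Fin n)) : ℝ)}

/-- The simulation-based parameter `λ* = c₀ Q_{Ψᵈ(Sₙ)}(1 - α₀)`. -/
def lambdaStar (𝓖 : WeightedGroups p g) (X : Matrix (Fin n) (Fin p) ℝ) (c₀ α₀ : ℝ) : ℝ :=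
  c₀ * permQuantile (fun σ => dualPsi 𝓖 (Sn X σ)) (1 - α₀)

open Classical in
/-- The support `S₀` of `β`. -/
def supp (β : EuclideanSpace ℝ (Fin p)) : Finset (Fin p) :=
  Finset.univ.filter fun j => β j ≠ 0

open Classical in
/-- The set `A₀` of the indices of the groups that meet the support of `β`. -/
def activeGroups (𝓖 : WeightedGroups p g) (β : EuclideanSpace ℝ (Fin p)) : Finset (Fin g) :=
  Finset.univ.filter fun l => (𝓖.G l ∩ supp β).Nonempty

/-- The group-expanded support `Ω`, the union of the active groups. -/
def expandedSupp (𝓖 : WeightedGroups p g) (β : EuclideanSpace ℝ (Fin p)) : Finset (Fin p) :=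
  (activeGroups 𝓖 β).biUnion 𝓖.G

/-- The coordinate projection: equal to `γ` on `s` and to zero elsewhere. -/
def proj (s : Finset (Fin p)) (γ : EuclideanSpace ℝ (Fin p)) : EuclideanSpace ℝ (Fin p) :=
  WithLp.toLp 2 fun j => if j ∈ s then γ j else 0

/-- `c_{|Ω|} = (∑_{l ∈ A₀} wₗ²)^{1/2}`. -/
def cOmega (𝓖 : WeightedGroups p g) (β : EuclideanSpace ℝ (Fin p)) : ℝ :=
  Real.sqrt (∑ l ∈ activeGroups 𝓖 β, 𝓖.w l ^ 2)

/-- `c_p = maxₗ wₗ⁻¹ |Gₗ|^{1/2}`. -/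
def cP (𝓖 : WeightedGroups p g) : ℝ :=
  ⨆ l, (𝓖.w l)⁻¹ * Real.sqrt ((𝓖.G l).card : ℝ)

/-- `c̄ = 1 + (c₀ + 1) / (c₀ - 1)`. -/
def cBar (c₀ : ℝ) : ℝ := 1 + (c₀ + 1) / (c₀ - 1)

/-- `𝓔(n, p) = log p / n + (log p / n)^{1/2}`. -/
def rate (n p : ℕ) : ℝ := Real.log p / n + Real.sqrt (Real.log p / n)

/-- The restricted eigenvalue condition with constant `b₂`: the infimum of
`γᵀXᵀXγ / (n ‖γ‖₂²)` over the nonzero `γ` with `Ψ_{Ωᶜ}(γ) ≤ (c̄ - 1) Ψ_Ω(γ)` is at least `b₂`. -/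
def RestrictedEigenvalue (𝓖 : WeightedGroups p g) (X : Matrix (Fin n) (Fin p) ℝ)
    (βs : EuclideanSpace ℝ (Fin p)) (c₀ b₂ : ℝ) : Prop :=
  ∀ γ : EuclideanSpace ℝ (Fin p), γ ≠ 0 →
    Psi 𝓖 (proj (expandedSupp 𝓖 βs)ᶜ γ) ≤ (cBar c₀ - 1) * Psi 𝓖 (proj (expandedSupp 𝓖 βs) γ) →
    b₂ ≤ (γ.ofLp ⬝ᵥ ((Xᵀ * X) *ᵥ γ.ofLp)) / ((n : ℝ) * ‖γ‖ ^ 2)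

/-- `f` is a probability density function of the real random variable `Z` under `μ`. -/
def HasDensity {S : Type*} [MeasurableSpace S] (μ : Measure S) (Z : S → ℝ) (f : ℝ → ℝ) : Prop :=
  Measurable f ∧ (∀ t, 0 ≤ f t) ∧
    Measure.map Z μ = (volume : Measure ℝ).withDensity fun t => ENNReal.ofReal (f t)

end

end RankLasso

/-! Write the error as `γ = β̂ - β*` and compare the loss at `β*` and at `β* + γ`. The increment
`excess` is a convex function of `γ`, and it is a U-statistic of order two in the errors. Minimality
gives `excess γ ≤ λ* (Ψ(β*) - Ψ(β* + γ))`.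

Cone. The vector `score` is a subgradient of the excess at zero and depends on the errors only
through their ranks. Hence it has exactly the law of `Sₙ` (`measureReal_score`), and `c₀ Ψᵈ(score) ≤
λ*` with probability at least `1 - α₀`. On that event the error lies in the restricted eigenvalue
cone (`Psi_compl_le_of_excess_le`).

Curvature. Differences of errors are symmetric, so the mean of `|z - t| - |z|` is the mean of `max
(|t| - |z|) 0`, which is at least `b₃ t²` (`mul_sq_le_meanShift`). With the eigenvalue condition the
mean excess is at least `2 b₂ b₃ R²` on the part of the cone at norm `R` (`le_meanExcess`).

Fluctuation. By Hoeffding's device a U-statistic is an average over permutations of sums over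
disjoint, hence independent, pairs. For such sums, symmetrization and contraction at the level of
exponential moments replace the process by a linear one with random signs, which is bounded by
hyperbolic cosines (`lintegral_exp_iSup_le_cosh`, `measure_pairMean_ge_le`). The resulting tail
bound serves twice: for the uniform deviation of the excess over the cone, and for the score, which
gives `λ* ≤ 7 b₁ c₀ c_p (log p / n)^{1/2}` (`lambdaStar_le`).

Conclusion. By convexity an error longer than `R` could be shrunk to norm `R` with the excess still
at most `λ* c_{|Ω|} R`. For the stated `R` the curvature exceeds this plus the fluctuation, a
contradiction. -/

namespace RankLasso

/-! ### Contraction and symmetrization for exponential moments of finite suprema. -/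

/-- Weak majorization for sums of two exponentials. -/
theorem exp_add_exp_le {p₁ p₂ q₁ q₂ : ℝ} (hsum : p₁ + p₂ ≤ q₁ + q₂) (h₁ : p₁ ≤ max q₁ q₂)
    (h₂ : p₂ ≤ max q₁ q₂) : Real.exp p₁ + Real.exp p₂ ≤ Real.exp q₁ + Real.exp q₂ := by
  wlog hq : q₂ ≤ q₁ generalizing q₁ q₂
  · have := this (q₁ := q₂) (q₂ := q₁) (by linarith) (by rwa [max_comm]) (by rwa [max_comm])
      (le_of_not_ge hq)
    linarith
  wlog hp : p₂ ≤ p₁ generalizing p₁ p₂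
  · have := this (p₁ := p₂) (p₂ := p₁) (by linarith) h₂ h₁ (le_of_not_ge hp)
    linarith
  rw [max_eq_left hq] at h₁ h₂
  -- Tangent lines at `p₁` and `p₂` bound the gain below by `exp p₁ (q₁ - p₁) + exp p₂ (q₂ - p₂)`.
  -- As `q₁ ≥ p₁` and `exp p₁ ≥ exp p₂`, this is at least `exp p₂` times the difference of the sums.
  have tangent : ∀ x y : ℝ, Real.exp x * (y - x) ≤ Real.exp y - Real.exp x := by
    intro x y
    have h := Real.add_one_le_exp (y - x)
    have h' : Real.exp y = Real.exp x * Real.exp (y - x) := by rw [← Real.exp_add]; ring_nf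
    rw [h']
    nlinarith [Real.exp_pos x]
  have e := Real.exp_le_exp.2 hp
  nlinarith [tangent p₁ q₁, tangent p₂ q₂, Real.exp_pos p₂,
    mul_nonneg (sub_nonneg.2 e) (sub_nonneg.2 h₁),
    mul_nonneg (Real.exp_pos p₂).le (by linarith : 0 ≤ q₂ - p₂ + (q₁ - p₁))]

section FiniteSup

variable {ι : Type*} [Finite ι]

theorem le_iSup_finite (A : ι → ℝ) (i : ι) : A i ≤ ⨆ j, A j :=
  le_ciSup (Set.finite_range A).bddAbove i

theorem measurable_exp_iSup {Ω : Type*} [MeasurableSpace Ω] {A : ι → Ω → ℝ}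
    (hA : ∀ i, Measurable (A i)) :
    Measurable fun ω => ENNReal.ofReal (Real.exp (⨆ i, A i ω)) := by
  have : Measurable fun ω => ⨆ i, A i ω := Measurable.iSup hA
  fun_prop

variable [Nonempty ι]

/-- The contraction principle for one random sign and the exponential function. -/
theorem exp_iSup_contraction (A h t : ι → ℝ) (hlip : ∀ i j, |h i - h j| ≤ |t i - t j|)
    (hle : ∀ i, |h i| ≤ |t i|) :
    Real.exp (⨆ i, (A i + h i)) + Real.exp (⨆ i, (A i - h i)) ≤
      Real.exp (⨆ i, (A i + t i)) + Real.exp (⨆ i, (A i - t i)) := by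
  obtain ⟨u, hu⟩ := exists_eq_ciSup_of_finite (f := fun i => A i + h i)
  obtain ⟨v, hv⟩ := exists_eq_ciSup_of_finite (f := fun i => A i - h i)
  have pu := le_iSup_finite (fun i => A i + t i) u
  have pv := le_iSup_finite (fun i => A i + t i) v
  have mu := le_iSup_finite (fun i => A i - t i) u
  have mv := le_iSup_finite (fun i => A i - t i) v
  rw [← hu, ← hv]
  set P := ⨆ i, (A i + t i)
  set M := ⨆ i, (A i - t i)
  have mP := le_max_left P M
  have mM := le_max_right P M
  have key := hlip u v
  have hu' := hle u
  have hv' := hle v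
  -- The maximizers `u` and `v` of the left side serve as competitors on the right: one in `P` and
  -- the other in `M`, in the order given by the sign of `t u - t v`. The bound `|h| ≤ |t|` controls
  -- each exponent separately.
  refine exp_add_exp_le ?_ ?_ ?_
  · have := (abs_le.1 key).2
    have := le_abs_self (h u - h v)
    rcases abs_cases (t u - t v) with ⟨e, _⟩ | ⟨e, _⟩ <;> linarith
  · have := le_abs_self (h u)
    rcases abs_cases (t u) with ⟨e, _⟩ | ⟨e, _⟩ <;> linarith
  · have := neg_abs_le (h v)
    rcases abs_cases (t v) with ⟨e, _⟩ | ⟨e, _⟩ <;> linarith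

/-- The exponential moment of the supremum of `A + g`, for a random perturbation `g` with law `P`,
is at most that of the supremum of `A ± u` with a random sign. -/
def SignDominated (P : Measure ℝ) (g : ι → ℝ → ℝ) (u : ι → ℝ) : Prop :=
  ∀ A : ι → ℝ, ∫⁻ z, ENNReal.ofReal (Real.exp (⨆ i, (A i + g i z))) ∂P ≤
    ENNReal.ofReal ((Real.exp (⨆ i, (A i + u i)) + Real.exp (⨆ i, (A i - u i))) / 2)

/-- If `2 A = B + C`, then `exp (sup A) ≤ (exp (sup B) + exp (sup C)) / 2`. -/
theorem exp_iSup_midpoint (A B C : ι → ℝ) (h : ∀ i, 2 * A i = B i + C i) :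
    Real.exp (⨆ i, A i) ≤ (Real.exp (⨆ i, B i) + Real.exp (⨆ i, C i)) / 2 := by
  obtain ⟨i, hi⟩ := exists_eq_ciSup_of_finite (f := A)
  rw [← hi]
  have hB := Real.exp_le_exp.2 (le_iSup_finite B i)
  have hC := Real.exp_le_exp.2 (le_iSup_finite C i)
  have : Real.exp (A i) + Real.exp (A i) ≤ Real.exp (B i) + Real.exp (C i) := by
    have := h i
    refine exp_add_exp_le (by linarith) ?_ ?_ <;>
      · rcases le_total (B i) (C i) with e | e
        · rw [max_eq_right e]; linarith
        · rw [max_eq_left e]; linarith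
  linarith

/-- Jensen's inequality for the exponential of a finite supremum. -/
theorem exp_iSup_integral_le (P : Measure ℝ) [IsProbabilityMeasure P] (A : ι → ℝ)
    (g : ι → ℝ → ℝ) (hg : ∀ i, Measurable (g i)) (C : ℝ) (hC : ∀ i z, |g i z| ≤ C) :
    ENNReal.ofReal (Real.exp (⨆ i, (A i + ∫ z, g i z ∂P))) ≤
      ∫⁻ z, ENNReal.ofReal (Real.exp (⨆ i, (A i + g i z))) ∂P := by
  obtain ⟨i, hi⟩ := exists_eq_ciSup_of_finite (f := fun i => A i + ∫ z, g i z ∂P)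
  have hint : Integrable (g i) P :=
    Integrable.of_bound (hg i).aestronglyMeasurable C (Filter.Eventually.of_forall (hC i))
  have hint' : Integrable (fun z => A i + g i z) P := (integrable_const _).add hint
  have hexp : Integrable (fun z => Real.exp (A i + g i z)) P := by
    refine Integrable.of_bound (by have := hg i; fun_prop) (Real.exp (A i + C))
      (Filter.Eventually.of_forall fun z => ?_)
    rw [Real.norm_of_nonneg (Real.exp_pos _).le]
    exact Real.exp_le_exp.2 (by linarith [(abs_le.1 (hC i z)).2])
  have jensen : Real.exp (∫ z, (A i + g i z) ∂P) ≤ ∫ z, Real.exp (A i + g i z) ∂P :=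
    convexOn_exp.map_integral_le Real.continuous_exp.continuousOn isClosed_univ (by simp)
      hint' hexp
  rw [integral_add (integrable_const _) hint] at jensen
  simp only [integral_const, probReal_univ, smul_eq_mul, one_mul] at jensen
  rw [← hi]
  refine (ENNReal.ofReal_le_ofReal jensen).trans ?_
  rw [ofReal_integral_eq_lintegral_ofReal hexp
    (Filter.Eventually.of_forall fun z => (Real.exp_pos _).le)]
  exact lintegral_mono fun z => ENNReal.ofReal_le_ofReal
    (Real.exp_le_exp.2 (le_iSup_finite (fun i => A i + g i z) i))

/-- Symmetrization and contraction: centred Lipschitz functions of `t`. -/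
theorem signDominated_of_lipschitz (P : Measure ℝ) [IsProbabilityMeasure P]
    (h : ι → ℝ → ℝ) (t : ι → ℝ) (hmeas : ∀ i, Measurable (h i))
    (hlip : ∀ z i j, |h i z - h j z| ≤ |t i - t j|) (hle : ∀ z i, |h i z| ≤ |t i|) :
    SignDominated P (fun i z => (∫ x, h i x ∂P) - h i z) (fun i => 2 * t i) := by
  intro A
  obtain ⟨C, hC⟩ : ∃ C, ∀ i, |t i| ≤ C :=
    ⟨⨆ i, |t i|, fun i => le_iSup_finite (fun i => |t i|) i⟩
  have e : ∀ i, ∫ x, 2 * h i x ∂P = 2 * ∫ x, h i x ∂P := fun i => integral_const_mul _ _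
  -- No independent copy is needed: `A + E h - h` is the midpoint of `A + 2 E h` and `A - 2 h`, and
  -- Jensen's inequality moves the first mean outside. The price is the factor 2 in the comparison
  -- function.
  calc ∫⁻ z, ENNReal.ofReal (Real.exp (⨆ i, (A i + ((∫ x, h i x ∂P) - h i z)))) ∂P
      ≤ ∫⁻ z, (ENNReal.ofReal (Real.exp (⨆ i, (A i + ∫ x, 2 * h i x ∂P))) +
          ENNReal.ofReal (Real.exp (⨆ i, (A i - 2 * h i z)))) / 2 ∂P := by
        refine lintegral_mono fun z => ?_
        rw [← ENNReal.ofReal_add (Real.exp_pos _).le (Real.exp_pos _).le,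
          show (2 : ENNReal) = ENNReal.ofReal 2 by simp,
          ← ENNReal.ofReal_div_of_pos two_pos]
        refine ENNReal.ofReal_le_ofReal (exp_iSup_midpoint _ _ _ fun i => ?_)
        rw [e]; ring
    _ = (ENNReal.ofReal (Real.exp (⨆ i, (A i + ∫ x, 2 * h i x ∂P))) +
          ∫⁻ z, ENNReal.ofReal (Real.exp (⨆ i, (A i - 2 * h i z))) ∂P) / 2 := by
        simp only [div_eq_mul_inv]
        rw [lintegral_mul_const, lintegral_add_left measurable_const, lintegral_const, measure_univ,
          mul_one]
        exact measurable_const.add (measurable_exp_iSup fun i => by have := hmeas i; fun_prop)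
    _ ≤ (∫⁻ z, ENNReal.ofReal (Real.exp (⨆ i, (A i + 2 * h i z))) ∂P +
          ∫⁻ z, ENNReal.ofReal (Real.exp (⨆ i, (A i - 2 * h i z))) ∂P) / 2 := by
        gcongr
        exact exp_iSup_integral_le P A (fun i z => 2 * h i z)
          (fun i => by have := hmeas i; fun_prop) (2 * C) (fun i z => by
            rw [abs_mul, abs_two]; linarith [hle z i, hC i])
    _ = (∫⁻ z, ENNReal.ofReal (Real.exp (⨆ i, (A i + 2 * h i z)) +
          Real.exp (⨆ i, (A i - 2 * h i z))) ∂P) / 2 := by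
        rw [← lintegral_add_left (measurable_exp_iSup fun i => by have := hmeas i; fun_prop)]
        congr 1
        refine lintegral_congr fun z => ?_
        rw [ENNReal.ofReal_add (Real.exp_pos _).le (Real.exp_pos _).le]
    _ ≤ (∫⁻ z, ENNReal.ofReal (Real.exp (⨆ i, (A i + 2 * t i)) +
          Real.exp (⨆ i, (A i - 2 * t i))) ∂P) / 2 := by
        refine ENNReal.div_le_div_right (lintegral_mono fun z => ENNReal.ofReal_le_ofReal ?_) _
        refine exp_iSup_contraction A (fun i => 2 * h i z) (fun i => 2 * t i) ?_ ?_
        · intro i j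
          rw [← mul_sub, ← mul_sub, abs_mul, abs_mul]
          exact mul_le_mul_of_nonneg_left (hlip z i j) (abs_nonneg _)
        · intro i
          rw [abs_mul, abs_mul]
          exact mul_le_mul_of_nonneg_left (hle z i) (abs_nonneg _)
    _ = _ := by
        rw [lintegral_const, measure_univ, mul_one, ENNReal.ofReal_div_of_pos two_pos]
        simp

theorem measurable_sign_real : Measurable fun z : ℝ => (SignType.sign z : ℝ) := by
  have : (fun z : ℝ => (SignType.sign z : ℝ)) =
      fun z => if 0 < z then 1 else if z < 0 then -1 else 0 := by
    funext z
    rw [sign_apply]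
    split_ifs <;> simp
  rw [this]
  exact Measurable.ite measurableSet_Ioi measurable_const
    (Measurable.ite measurableSet_Iio measurable_const measurable_const)

/-- Multiples of the sign of a symmetric random variable. -/
theorem signDominated_sign (P : Measure ℝ) [IsProbabilityMeasure P]
    (hsymm : P.map (fun z => -z) = P) (t : ι → ℝ) :
    SignDominated P (fun i z => -(t i * (SignType.sign z : ℝ))) t := by
  intro A
  have hs := measurable_sign_real
  set F : ℝ → ENNReal := fun z =>
    ENNReal.ofReal (Real.exp (⨆ i, (A i + -(t i * (SignType.sign z : ℝ))))) with hF
  have hFm : Measurable F := measurable_exp_iSup fun i => by fun_prop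
  have hneg : ∫⁻ z, F z ∂P = ∫⁻ z, F (-z) ∂P := by
    conv_lhs => rw [← hsymm]
    rw [lintegral_map hFm measurable_neg]
  -- Symmetry allows averaging over `z` and `-z`. Contraction then covers a vanishing sign as well,
  -- so no factor 2 is lost here.
  have hdouble : ∫⁻ z, F z ∂P + ∫⁻ z, F z ∂P ≤
      ENNReal.ofReal (Real.exp (⨆ i, (A i + t i)) + Real.exp (⨆ i, (A i - t i))) := by
    conv_lhs => rw [hneg]
    rw [← hneg]
    nth_rewrite 2 [hneg]
    rw [← lintegral_add_left hFm]
    calc ∫⁻ z, F z + F (-z) ∂P ≤ ∫⁻ _, ENNReal.ofReal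
          (Real.exp (⨆ i, (A i + t i)) + Real.exp (⨆ i, (A i - t i))) ∂P := by
          refine lintegral_mono fun z => ?_
          simp only [hF]
          rw [← ENNReal.ofReal_add (Real.exp_pos _).le (Real.exp_pos _).le]
          refine ENNReal.ofReal_le_ofReal ?_
          have := exp_iSup_contraction A (fun i => -(t i * (SignType.sign z : ℝ))) t ?_ ?_
          · refine le_trans (le_of_eq ?_) this
            congr 3
            funext i
            rw [Left.sign_neg]
            simp
          · intro i j
            rcases SignType.sign z with _ | _ | _ <;> simp [abs_sub_comm, add_comm, ← sub_eq_add_neg]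
          · intro i
            rcases SignType.sign z with _ | _ | _ <;> simp
      _ = _ := by simp
  rw [ENNReal.ofReal_div_of_pos two_pos]
  rw [ENNReal.le_div_iff_mul_le (by simp) (by simp)]
  rw [show ENNReal.ofReal 2 = 2 by simp, mul_two]
  exact hdouble

end FiniteSup

/-! ### Exponential moments over independent pairs. -/

section Exponential

variable {ι : Type*} [Finite ι] [Nonempty ι]

/-- By `ℓ₁`-`ℓ∞` duality the supremum is at most `ρ` times the largest `|a j|`. Bounding that
maximum by a sum over coordinates is the origin of the factor `2 p` in the tails. -/
theorem exp_iSup_dot_le {p : ℕ} (v : ι → Fin p → ℝ) {ρ : ℝ} (hv : ∀ i, ∑ j, |v i j| ≤ ρ)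
    (hp : 0 < p) (a : Fin p → ℝ) :
    Real.exp (⨆ i, a ⬝ᵥ v i) ≤ ∑ j, 2 * Real.cosh (ρ * a j) := by
  obtain ⟨i, hi⟩ := exists_eq_ciSup_of_finite (f := fun i => a ⬝ᵥ v i)
  rw [← hi]
  have : Nonempty (Fin p) := ⟨⟨0, hp⟩⟩
  obtain ⟨j, hj⟩ := exists_eq_ciSup_of_finite (f := fun j => |a j|)
  have hmax : ∀ k, |a k| ≤ |a j| := fun k => hj ▸ le_iSup_finite (fun j => |a j|) k
  have h1 : a ⬝ᵥ v i ≤ ρ * |a j| := by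
    calc a ⬝ᵥ v i ≤ ∑ k, |a j| * |v i k| := by
          refine Finset.sum_le_sum fun k _ => ?_
          calc a k * v i k ≤ |a k * v i k| := le_abs_self _
            _ = |a k| * |v i k| := abs_mul _ _
            _ ≤ _ := mul_le_mul_of_nonneg_right (hmax k) (abs_nonneg _)
      _ = |a j| * ∑ k, |v i k| := by rw [Finset.mul_sum]
      _ ≤ |a j| * ρ := mul_le_mul_of_nonneg_left (hv i) (abs_nonneg _)
      _ = _ := mul_comm _ _
  have h2 : Real.exp (ρ * |a j|) ≤ 2 * Real.cosh (ρ * a j) := by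
    rw [Real.cosh_eq]
    rcases abs_cases (a j) with ⟨e, _⟩ | ⟨e, _⟩ <;> rw [e]
    · linarith [Real.exp_pos (-(ρ * a j))]
    · rw [mul_neg]; linarith [Real.exp_pos (ρ * a j)]
  calc Real.exp (a ⬝ᵥ v i) ≤ Real.exp (ρ * |a j|) := Real.exp_le_exp.2 h1
    _ ≤ _ := h2
    _ ≤ _ := Finset.single_le_sum (f := fun j => 2 * Real.cosh (ρ * a j))
        (fun k _ => by have := Real.cosh_pos (ρ * a k); positivity) (Finset.mem_univ j)

/-- Induction on the number of pairs, with the linear offset `a` kept general. Fubini isolates one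
pair, and domination replaces its term by `± D m ⬝ᵥ v i`. This is linear in `v i`, so it only shifts
`a` to `a ± D m`, and `cosh (x + y) + cosh (x - y) = 2 cosh x cosh y` closes the induction. -/
theorem lintegral_exp_iSup_le_cosh {S α κ : Type*} [MeasurableSpace S] [DecidableEq α]
    [DecidableEq κ] (μ : Measure S) [IsProbabilityMeasure μ] {p : ℕ} (hp : 0 < p)
    (ε : α → S → ℝ) (hε : ∀ i, Measurable (ε i)) (hind : iIndepFun ε μ)
    (l r : κ → α) (hl : l.Injective) (hr : r.Injective) (hlr : ∀ m m', l m ≠ r m')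
    (v : ι → Fin p → ℝ) {ρ : ℝ} (hv : ∀ i, ∑ j, |v i j| ≤ ρ) (D : κ → Fin p → ℝ)
    (G : κ → ι → ℝ → ℝ) (hG : ∀ m i, Measurable (G m i))
    (hdom : ∀ m, SignDominated (μ.map fun s => ε (l m) s - ε (r m) s) (G m)
      (fun i => D m ⬝ᵥ v i)) (s : Finset κ) :
    ∀ a : Fin p → ℝ,
    ∫⁻ ω, ENNReal.ofReal (Real.exp (⨆ i, (a ⬝ᵥ v i +
        ∑ m ∈ s, G m i (ε (l m) ω - ε (r m) ω)))) ∂μ ≤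
      ENNReal.ofReal (∑ j, 2 * Real.cosh (ρ * a j) * ∏ m ∈ s, Real.cosh (ρ * D m j)) := by
  induction s using Finset.induction_on with
  | empty =>
    intro a
    simp only [Finset.sum_empty, add_zero, Finset.prod_empty, mul_one, lintegral_const,
      measure_univ]
    exact ENNReal.ofReal_le_ofReal (exp_iSup_dot_le v hv hp a)
  | insert m s hm ih =>
    intro a
    set V : S → ι → ℝ := fun ω i => ∑ m' ∈ s, G m' i (ε (l m') ω - ε (r m') ω) with hV
    set W : S → ℝ := fun ω => ε (l m) ω - ε (r m) ω with hW
    have hVm : Measurable V := measurable_pi_lambda _ fun i =>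
      Finset.measurable_fun_sum _ fun m' _ =>
        (hG m' i).comp ((hε _).sub (hε _))
    have hWm : Measurable W := (hε _).sub (hε _)
    have hVW : IndepFun V W μ := by
      have hdisj : Disjoint (s.image l ∪ s.image r) {l m, r m} := by
        rw [Finset.disjoint_left]
        intro x hx hx'
        simp only [Finset.mem_union, Finset.mem_image, Finset.mem_insert,
          Finset.mem_singleton] at hx hx'
        rcases hx with ⟨m', hm', rfl⟩ | ⟨m', hm', rfl⟩ <;> rcases hx' with h | h
        · exact hm (hl h ▸ hm')
        · exact hlr _ _ h
        · exact hlr _ _ h.symm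
        · exact hm (hr h ▸ hm')
      have base := hind.indepFun_finset _ _ hdisj hε
      have hφ : Measurable fun (x : (i : (s.image l ∪ s.image r : Finset α)) → ℝ) (i : ι) =>
          ∑ m' ∈ s.attach, G m' i
            (x ⟨l m', by simp only [Finset.mem_union, Finset.mem_image]; exact Or.inl ⟨m', m'.2, rfl⟩⟩
              - x ⟨r m', by simp only [Finset.mem_union, Finset.mem_image]; exact Or.inr ⟨m', m'.2, rfl⟩⟩) := by
        refine measurable_pi_lambda _ fun i => Finset.measurable_fun_sum _ fun m' _ => ?_
        exact (hG m' i).comp ((measurable_pi_apply _).sub (measurable_pi_apply _))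
      have hψ : Measurable fun (x : (i : ({l m, r m} : Finset α)) → ℝ) =>
          x ⟨l m, by simp⟩ - x ⟨r m, by simp⟩ :=
        (measurable_pi_apply _).sub (measurable_pi_apply _)
      have := base.comp hφ hψ
      convert this using 1
      · funext ω i
        simp only [hV, Function.comp]
        rw [← Finset.sum_attach]
      · rfl
    set F : (ι → ℝ) × ℝ → ENNReal := fun x =>
      ENNReal.ofReal (Real.exp (⨆ i, ((a ⬝ᵥ v i + x.1 i) + G m i x.2))) with hF
    have hFm : Measurable F := measurable_exp_iSup fun i =>
      (measurable_const.add ((measurable_pi_apply i).comp measurable_fst)).add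
        ((hG m i).comp measurable_snd)
    have : IsProbabilityMeasure (μ.map W) := Measure.isProbabilityMeasure_map hWm.aemeasurable
    have : IsProbabilityMeasure (μ.map V) := Measure.isProbabilityMeasure_map hVm.aemeasurable
    have hE' : ∀ b : Fin p → ℝ, Measurable fun x : ι → ℝ =>
        ENNReal.ofReal (Real.exp (⨆ i, (b ⬝ᵥ v i + x i))) := fun b =>
      measurable_exp_iSup fun i => measurable_const.add (measurable_pi_apply i)
    calc ∫⁻ ω, ENNReal.ofReal (Real.exp (⨆ i, (a ⬝ᵥ v i +
          ∑ m' ∈ insert m s, G m' i (ε (l m') ω - ε (r m') ω)))) ∂μ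
        = ∫⁻ ω, F (V ω, W ω) ∂μ := by
          refine lintegral_congr fun ω => ?_
          simp only [hF, hV, hW, Finset.sum_insert hm]
          congr 3
          funext i
          ring
      _ = ∫⁻ x, F x ∂((μ.map V).prod (μ.map W)) := by
          rw [← (indepFun_iff_map_prod_eq_prod_map_map hVm.aemeasurable hWm.aemeasurable).1 hVW,
            lintegral_map hFm (hVm.prodMk hWm)]
      _ = ∫⁻ x, ∫⁻ w, F (x, w) ∂(μ.map W) ∂(μ.map V) := lintegral_prod _ hFm.aemeasurable
      _ ≤ ∫⁻ x, (ENNReal.ofReal (Real.exp (⨆ i, ((a + D m) ⬝ᵥ v i + x i))) +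
            ENNReal.ofReal (Real.exp (⨆ i, ((a - D m) ⬝ᵥ v i + x i)))) / 2 ∂(μ.map V) := by
          refine lintegral_mono fun x => (hdom m fun i => a ⬝ᵥ v i + x i).trans (le_of_eq ?_)
          rw [ENNReal.ofReal_div_of_pos two_pos,
            ENNReal.ofReal_add (Real.exp_pos _).le (Real.exp_pos _).le]
          congr 1
          · congr 4 <;> funext i <;> simp only [add_dotProduct, sub_dotProduct] <;> ring
          · simp
      _ = (∫⁻ ω, ENNReal.ofReal (Real.exp (⨆ i, ((a + D m) ⬝ᵥ v i + V ω i))) ∂μ +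
            ∫⁻ ω, ENNReal.ofReal (Real.exp (⨆ i, ((a - D m) ⬝ᵥ v i + V ω i))) ∂μ) / 2 := by
          simp only [div_eq_mul_inv]
          rw [lintegral_mul_const' _ _ (by simp), lintegral_add_left (hE' _),
            lintegral_map (hE' _) hVm, lintegral_map (hE' _) hVm]
      _ ≤ (ENNReal.ofReal (∑ j, 2 * Real.cosh (ρ * (a + D m) j) *
              ∏ m ∈ s, Real.cosh (ρ * D m j)) +
            ENNReal.ofReal (∑ j, 2 * Real.cosh (ρ * (a - D m) j) *
              ∏ m ∈ s, Real.cosh (ρ * D m j))) / 2 :=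
          ENNReal.div_le_div_right (add_le_add (ih _) (ih _)) _
      _ = _ := by
          have nn : ∀ b : Fin p → ℝ, 0 ≤ ∑ j, 2 * Real.cosh (ρ * b j) *
              ∏ m ∈ s, Real.cosh (ρ * D m j) := fun b =>
            Finset.sum_nonneg fun j _ => mul_nonneg
              (by have := Real.cosh_pos (ρ * b j); positivity)
              (Finset.prod_nonneg fun m' _ => (Real.cosh_pos _).le)
          rw [← ENNReal.ofReal_add (nn _) (nn _), show (2 : ENNReal) = ENNReal.ofReal 2 by simp,
            ← ENNReal.ofReal_div_of_pos two_pos, ← Finset.sum_add_distrib, Finset.sum_div]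
          congr 1
          refine Finset.sum_congr rfl fun j _ => ?_
          rw [Finset.prod_insert hm, Pi.add_apply, Pi.sub_apply, mul_add, mul_sub, Real.cosh_add,
            Real.cosh_sub]
          ring

/-- Convexity of `exp ∘ sup` over a finite average. -/
theorem exp_iSup_average_le {T : Type*} [Fintype T] [Nonempty T] (a : T → ι → ℝ) :
    Real.exp (⨆ i, (Fintype.card T : ℝ)⁻¹ * ∑ τ, a τ i) ≤
      (Fintype.card T : ℝ)⁻¹ * ∑ τ, Real.exp (⨆ i, a τ i) := by
  obtain ⟨i, hi⟩ := exists_eq_ciSup_of_finite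
    (f := fun i => (Fintype.card T : ℝ)⁻¹ * ∑ τ, a τ i)
  rw [← hi]
  have hc : (0 : ℝ) < Fintype.card T := by exact_mod_cast Fintype.card_pos
  have := convexOn_exp.map_sum_le (t := Finset.univ) (w := fun _ : T => (Fintype.card T : ℝ)⁻¹)
    (p := fun τ => a τ i) (fun _ _ => by positivity)
    (by simp [Finset.sum_const, hc.ne']) (fun _ _ => Set.mem_univ _)
  simp only [smul_eq_mul, ← Finset.mul_sum] at this
  refine this.trans (mul_le_mul_of_nonneg_left (Finset.sum_le_sum fun τ _ =>
    Real.exp_le_exp.2 (le_iSup_finite (a τ) i)) (by positivity))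

end Exponential

/-! ### Hoeffding's representation of U-statistics. -/

section PermutationAverage

variable {n : ℕ}

/-- The average of `a i j` over the ordered pairs `i ≠ j`. -/
noncomputable def pairMean (a : Fin n → Fin n → ℝ) : ℝ :=
  1 / ((n : ℝ) * ((n : ℝ) - 1)) * ∑ i, ∑ j ∈ Finset.univ.erase i, a i j

theorem sum_offDiag_perm (a : Fin n → Fin n → ℝ) (τ : Equiv.Perm (Fin n)) :
    ∑ i, ∑ j ∈ Finset.univ.erase i, a (τ i) (τ j) = ∑ i, ∑ j ∈ Finset.univ.erase i, a i j := by
  rw [← Equiv.sum_comp τ (fun i => ∑ j ∈ Finset.univ.erase i, a i j)]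
  refine Finset.sum_congr rfl fun i _ => ?_
  refine Finset.sum_bij (fun j _ => τ j) ?_ ?_ ?_ ?_
  · intro j hj; simpa using hj
  · intro j _ k _ h; exact τ.injective h
  · intro j hj; exact ⟨τ.symm j, by simpa [Equiv.symm_apply_eq] using hj, by simp⟩
  · intro j _; rfl

theorem pairMean_eq_perm_average (hn : 2 ≤ n) (a : Fin n → Fin n → ℝ) {i₀ j₀ : Fin n}
    (h₀ : i₀ ≠ j₀) :
    pairMean a = (Fintype.card (Equiv.Perm (Fin n)) : ℝ)⁻¹ *
      ∑ τ : Equiv.Perm (Fin n), a (τ i₀) (τ j₀) := by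
  set c := ∑ τ : Equiv.Perm (Fin n), a (τ i₀) (τ j₀) with hc
  -- The symmetric group is doubly transitive, so all ordered pairs give the same sum over `τ`.
  have hall : ∀ i j, i ≠ j → ∑ τ : Equiv.Perm (Fin n), a (τ i) (τ j) = c := by
    intro i j hij
    obtain ⟨π, hπ₁, hπ₂⟩ := MulAction.is_two_pretransitive_iff.1
      (Equiv.Perm.isMultiplyPretransitive (Fin n) 2) h₀ hij
    rw [hc, ← Equiv.sum_comp (Equiv.mulRight π) fun τ : Equiv.Perm (Fin n) => a (τ i₀) (τ j₀),
      ← hπ₁, ← hπ₂]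
    rfl
  have h1 : ∑ i, ∑ j ∈ Finset.univ.erase i, ∑ τ : Equiv.Perm (Fin n), a (τ i) (τ j) =
      (n : ℝ) * ((n : ℝ) - 1) * c := by
    rw [Finset.sum_congr rfl fun i _ => Finset.sum_congr rfl fun j hj =>
      hall i j (Finset.ne_of_mem_erase hj).symm]
    simp only [Finset.sum_const, Finset.card_erase_of_mem (Finset.mem_univ _), Finset.card_univ,
      Fintype.card_fin, nsmul_eq_mul]
    rw [Nat.cast_sub (by omega)]
    push_cast
    ring
  have h2 : ∑ i, ∑ j ∈ Finset.univ.erase i, ∑ τ : Equiv.Perm (Fin n), a (τ i) (τ j) =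
      (Fintype.card (Equiv.Perm (Fin n)) : ℝ) * ∑ i, ∑ j ∈ Finset.univ.erase i, a i j := by
    rw [Finset.sum_congr rfl fun i _ => Finset.sum_comm, Finset.sum_comm,
      Finset.sum_congr rfl fun τ _ => sum_offDiag_perm a τ, Finset.sum_const, nsmul_eq_mul,
      Finset.card_univ]
  have hn' : (2 : ℝ) ≤ n := by exact_mod_cast hn
  have hN : (0 : ℝ) < Fintype.card (Equiv.Perm (Fin n)) := by exact_mod_cast Fintype.card_pos
  have hd : (0 : ℝ) < (n : ℝ) * ((n : ℝ) - 1) := by nlinarith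
  rw [pairMean]
  rw [h2] at h1
  rw [one_div, inv_mul_eq_div, inv_mul_eq_div, div_eq_div_iff hd.ne' hN.ne']
  linarith

/-- When the pairs `(l m, r m)` are disjoint, each inner sum has independent terms; this is how the
dependence inside the U-statistic is removed. -/
theorem pairMean_eq_average_of_pairs (hn : 2 ≤ n) (a : Fin n → Fin n → ℝ) {k : ℕ} (hk : 0 < k)
    (l r : Fin k → Fin n) (hlr : ∀ m, l m ≠ r m) :
    pairMean a = (Fintype.card (Equiv.Perm (Fin n)) : ℝ)⁻¹ *
      ∑ τ : Equiv.Perm (Fin n), ∑ m, (k : ℝ)⁻¹ * a (τ (l m)) (τ (r m)) := by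
  rw [Finset.sum_comm, Finset.mul_sum]
  have hk' : (k : ℝ) ≠ 0 := by positivity
  have : ∀ m : Fin k, (Fintype.card (Equiv.Perm (Fin n)) : ℝ)⁻¹ *
      ∑ τ : Equiv.Perm (Fin n), (k : ℝ)⁻¹ * a (τ (l m)) (τ (r m)) = (k : ℝ)⁻¹ * pairMean a := by
    intro m
    rw [pairMean_eq_perm_average hn a (hlr m), ← Finset.mul_sum]
    ring
  rw [Finset.sum_congr rfl fun m _ => this m]
  simp [hk']

end PermutationAverage

/-! ### The tail bound for suprema of U-statistics. -/

section Tail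

variable {ι : Type*} [Finite ι] [Nonempty ι]

/-- Exponential tail bound for the supremum of a finite family of U-statistics of order two. -/
theorem measure_pairMean_ge_le {S : Type*} [MeasurableSpace S] (μ : Measure S)
    [IsProbabilityMeasure μ] {n p : ℕ} (hn : 2 ≤ n) (hp : 0 < p) (X : Matrix (Fin n) (Fin p) ℝ)
    {b₁ : ℝ} (hb₁ : 0 < b₁) (hX : ∀ i j, |X i j| ≤ b₁)
    (ε : Fin n → S → ℝ) (hε : ∀ i, Measurable (ε i)) (hind : iIndepFun ε μ)
    (v : ι → Fin p → ℝ) {ρ : ℝ} (hρ : 0 < ρ) (hv : ∀ i, ∑ j, |v i j| ≤ ρ) {c : ℝ} (hc : 0 < c)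
    (g : Fin n → Fin n → ι → ℝ → ℝ) (hg : ∀ i j γ, Measurable (g i j γ))
    (hdom : ∀ i j, i ≠ j → ∀ s : ℝ, 0 < s →
      SignDominated (μ.map fun ω => ε i ω - ε j ω) (fun γ z => s * g i j γ z)
        (fun γ => (fun q => c * s * (X i q - X j q)) ⬝ᵥ v γ)) {T : ℝ} (hT : 0 < T) :
    μ {ω | ∃ γ, T ≤ pairMean fun i j => g i j γ (ε i ω - ε j ω)} ≤
      ENNReal.ofReal (2 * p * Real.exp (-(n * T ^ 2 / (24 * (c * ρ * b₁) ^ 2)))) := by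
  set k := n / 2 with hk
  have hk0 : 0 < k := by omega
  -- The worst case is `n = 3`, where `k = 1`; this turns the 8 of the exponent into 24.
  have hk3 : (n : ℝ) ≤ 3 * k := by exact_mod_cast (by omega : n ≤ 3 * k)
  have hkR : (0 : ℝ) < k := by exact_mod_cast hk0
  let l : Fin k → Fin n := fun m => ⟨2 * m, by omega⟩
  let r : Fin k → Fin n := fun m => ⟨2 * m + 1, by omega⟩
  have hl : l.Injective := fun x y h => by
    simp only [l, Fin.mk.injEq] at h; omega
  have hr : r.Injective := fun x y h => by
    simp only [r, Fin.mk.injEq] at h; omega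
  have hlr : ∀ m m', l m ≠ r m' := fun x y h => by
    simp only [l, r, Fin.mk.injEq] at h; omega
  set N : ℝ := (Fintype.card (Equiv.Perm (Fin n)) : ℝ) with hN
  have hNpos : 0 < N := by rw [hN]; exact_mod_cast Fintype.card_pos
  -- The minimizer of the Chernoff exponent `2 (c ρ b₁)² s² / k - s T`.
  set s : ℝ := k * T / (4 * (c * ρ * b₁) ^ 2) with hs
  have hcρ : 0 < c * ρ * b₁ := by positivity
  have hs0 : 0 < s := by positivity
  set Y : S → ℝ := fun ω => ⨆ γ, s * pairMean fun i j => g i j γ (ε i ω - ε j ω) with hY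
  have hperm : ∀ τ : Equiv.Perm (Fin n),
      ∫⁻ ω, ENNReal.ofReal (Real.exp (⨆ γ, ∑ m : Fin k,
        s / k * g (τ (l m)) (τ (r m)) γ (ε (τ (l m)) ω - ε (τ (r m)) ω))) ∂μ ≤
      ENNReal.ofReal (2 * p * Real.exp (2 * (c * ρ * b₁) ^ 2 * s ^ 2 / k)) := by
    intro τ
    have h := lintegral_exp_iSup_le_cosh μ hp ε hε hind (fun m => τ (l m)) (fun m => τ (r m))
      (τ.injective.comp hl) (τ.injective.comp hr) (fun m m' h => hlr m m' (τ.injective h)) v hv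
      (fun m q => c * (s / k) * (X (τ (l m)) q - X (τ (r m)) q))
      (fun m γ z => s / k * g (τ (l m)) (τ (r m)) γ z)
      (fun m γ => (hg _ _ γ).const_mul _)
      (fun m => hdom _ _ (fun h => hlr m m (τ.injective h)) _ (by positivity)) Finset.univ 0
    simp only [zero_dotProduct, zero_add, Pi.zero_apply, mul_zero, Real.cosh_zero, mul_one] at h
    refine h.trans (ENNReal.ofReal_le_ofReal ?_)
    calc ∑ j, 2 * ∏ m : Fin k, Real.cosh (ρ * (c * (s / k) * (X (τ (l m)) j - X (τ (r m)) j)))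
        ≤ ∑ _j : Fin p, 2 * ∏ _m : Fin k, Real.exp (2 * (c * ρ * b₁) ^ 2 * s ^ 2 / k ^ 2) := by
          refine Finset.sum_le_sum fun j _ => ?_
          refine mul_le_mul_of_nonneg_left ?_ two_pos.le
          refine Finset.prod_le_prod (fun m _ => (Real.cosh_pos _).le) fun m _ => ?_
          refine (Real.cosh_le_exp_half_sq _).trans (Real.exp_le_exp.2 ?_)
          have hx : (X (τ (l m)) j - X (τ (r m)) j) ^ 2 ≤ (2 * b₁) ^ 2 := by
            have h1 := abs_le.1 (hX (τ (l m)) j)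
            have h2 := abs_le.1 (hX (τ (r m)) j)
            exact sq_le_sq' (by linarith) (by linarith)
          calc (ρ * (c * (s / k) * (X (τ (l m)) j - X (τ (r m)) j))) ^ 2 / 2
              = (ρ * c * (s / k)) ^ 2 * (X (τ (l m)) j - X (τ (r m)) j) ^ 2 / 2 := by ring
            _ ≤ (ρ * c * (s / k)) ^ 2 * (2 * b₁) ^ 2 / 2 := by gcongr
            _ = _ := by field_simp
      _ = 2 * p * Real.exp (2 * (c * ρ * b₁) ^ 2 * s ^ 2 / k) := by
          simp only [Finset.prod_const, Finset.sum_const, Finset.card_univ, Fintype.card_fin,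
            nsmul_eq_mul]
          rw [← Real.exp_nat_mul]
          have : (k : ℝ) * (2 * (c * ρ * b₁) ^ 2 * s ^ 2 / k ^ 2) =
              2 * (c * ρ * b₁) ^ 2 * s ^ 2 / k := by field_simp
          rw [this]; ring
  have hYm : Measurable fun ω => ENNReal.ofReal (Real.exp (Y ω)) := by
    refine measurable_exp_iSup fun γ => Measurable.const_mul ?_ _
    unfold pairMean
    refine Measurable.const_mul ?_ _
    refine Finset.measurable_fun_sum _ fun i _ => Finset.measurable_fun_sum _ fun j _ => ?_
    exact (hg i j γ).comp ((hε i).sub (hε j))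
  have hmgf : ∫⁻ ω, ENNReal.ofReal (Real.exp (Y ω)) ∂μ ≤
      ENNReal.ofReal (2 * p * Real.exp (2 * (c * ρ * b₁) ^ 2 * s ^ 2 / k)) := by
    calc ∫⁻ ω, ENNReal.ofReal (Real.exp (Y ω)) ∂μ
        ≤ ∫⁻ ω, ENNReal.ofReal N⁻¹ * ∑ τ : Equiv.Perm (Fin n),
            ENNReal.ofReal (Real.exp (⨆ γ, ∑ m : Fin k,
              s / k * g (τ (l m)) (τ (r m)) γ (ε (τ (l m)) ω - ε (τ (r m)) ω))) ∂μ := by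
          refine lintegral_mono fun ω => ?_
          rw [← ENNReal.ofReal_sum_of_nonneg fun τ _ => (Real.exp_pos _).le,
            ← ENNReal.ofReal_mul (by positivity)]
          refine ENNReal.ofReal_le_ofReal (le_trans (le_of_eq ?_) (exp_iSup_average_le
            fun (τ : Equiv.Perm (Fin n)) γ => ∑ m : Fin k,
              s / k * g (τ (l m)) (τ (r m)) γ (ε (τ (l m)) ω - ε (τ (r m)) ω)))
          simp only [hY]
          congr 2
          funext γ
          rw [pairMean_eq_average_of_pairs hn _ hk0 l r fun m => hlr m m, mul_left_comm,
            Finset.mul_sum]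
          congr 1
          refine Finset.sum_congr rfl fun τ _ => ?_
          rw [Finset.mul_sum]
          refine Finset.sum_congr rfl fun m _ => ?_
          ring
      _ = ENNReal.ofReal N⁻¹ * ∑ τ : Equiv.Perm (Fin n),
            ∫⁻ ω, ENNReal.ofReal (Real.exp (⨆ γ, ∑ m : Fin k,
              s / k * g (τ (l m)) (τ (r m)) γ (ε (τ (l m)) ω - ε (τ (r m)) ω))) ∂μ := by
          have hm : ∀ τ : Equiv.Perm (Fin n), Measurable fun ω =>
              ENNReal.ofReal (Real.exp (⨆ γ, ∑ m : Fin k,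
                s / k * g (τ (l m)) (τ (r m)) γ (ε (τ (l m)) ω - ε (τ (r m)) ω))) := fun τ =>
            measurable_exp_iSup fun γ => Finset.measurable_fun_sum _ fun m _ =>
              ((hg _ _ γ).comp ((hε _).sub (hε _))).const_mul _
          rw [lintegral_const_mul _ (Finset.measurable_fun_sum _ fun τ _ => hm τ),
            lintegral_finsetSum _ fun τ _ => hm τ]
      _ ≤ ENNReal.ofReal N⁻¹ * ∑ _τ : Equiv.Perm (Fin n),
            ENNReal.ofReal (2 * p * Real.exp (2 * (c * ρ * b₁) ^ 2 * s ^ 2 / k)) := by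
          gcongr with τ _
          exact hperm τ
      _ = _ := by
          rw [Finset.sum_const, nsmul_eq_mul, ← mul_assoc, Finset.card_univ,
            ENNReal.ofReal_inv_of_pos hNpos, hN, ENNReal.ofReal_natCast,
            ENNReal.inv_mul_cancel (by simp) (by simp), one_mul]
  calc μ {ω | ∃ γ, T ≤ pairMean fun i j => g i j γ (ε i ω - ε j ω)}
      ≤ μ {ω | ENNReal.ofReal (Real.exp (s * T)) ≤ ENNReal.ofReal (Real.exp (Y ω))} := by
        refine measure_mono fun ω hω => ?_
        obtain ⟨γ, hγ⟩ := hω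
        refine ENNReal.ofReal_le_ofReal (Real.exp_le_exp.2 ?_)
        exact (mul_le_mul_of_nonneg_left hγ hs0.le).trans (le_iSup_finite
          (fun γ => s * pairMean fun i j => g i j γ (ε i ω - ε j ω)) γ)
    _ ≤ (∫⁻ ω, ENNReal.ofReal (Real.exp (Y ω)) ∂μ) / ENNReal.ofReal (Real.exp (s * T)) :=
        meas_ge_le_lintegral_div hYm.aemeasurable (by simp [Real.exp_pos]) (by simp)
    _ ≤ ENNReal.ofReal (2 * p * Real.exp (2 * (c * ρ * b₁) ^ 2 * s ^ 2 / k)) /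
          ENNReal.ofReal (Real.exp (s * T)) := ENNReal.div_le_div_right hmgf _
    _ ≤ _ := by
        rw [← ENNReal.ofReal_div_of_pos (Real.exp_pos _), mul_div_assoc, ← Real.exp_sub]
        refine ENNReal.ofReal_le_ofReal (mul_le_mul_of_nonneg_left (Real.exp_le_exp.2 ?_)
          (by positivity))
        have : 2 * (c * ρ * b₁) ^ 2 * s ^ 2 / k - s * T =
            -(k * T ^ 2 / (8 * (c * ρ * b₁) ^ 2)) := by
          rw [hs]; field_simp; ring
        rw [this, neg_le_neg_iff, div_le_div_iff₀ (by positivity) (by positivity)]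
        have : 0 ≤ T ^ 2 * (c * ρ * b₁) ^ 2 := by positivity
        nlinarith

end Tail

/-! ### The group norm and its dual. -/

section Regularizer

variable {p g : ℕ}

theorem proj_apply (s : Finset (Fin p)) (γ : EuclideanSpace ℝ (Fin p)) (j : Fin p) :
    proj s γ j = if j ∈ s then γ j else 0 := rfl

theorem proj_add (s : Finset (Fin p)) (γ δ : EuclideanSpace ℝ (Fin p)) :
    proj s (γ + δ) = proj s γ + proj s δ := by
  ext j
  simp only [proj_apply, PiLp.add_apply]
  split_ifs <;> simp

theorem proj_smul (s : Finset (Fin p)) (c : ℝ) (γ : EuclideanSpace ℝ (Fin p)) :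
    proj s (c • γ) = c • proj s γ := by
  ext j
  simp only [proj_apply, PiLp.smul_apply]
  split_ifs <;> simp

theorem norm_proj (s : Finset (Fin p)) (γ : EuclideanSpace ℝ (Fin p)) :
    ‖proj s γ‖ = Real.sqrt (∑ j ∈ s, γ j ^ 2) := by
  rw [EuclideanSpace.norm_eq]
  simp [proj_apply, apply_ite (fun x : ℝ => |x|), ite_pow, Finset.sum_ite_mem]

variable (𝓖 : WeightedGroups p g)

theorem Psi_eq_sum_norm (γ : EuclideanSpace ℝ (Fin p)) :
    Psi 𝓖 γ = ∑ l, 𝓖.w l * ‖proj (𝓖.G l) γ‖ := by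
  simp only [norm_proj, Psi]

theorem Psi_nonneg (γ : EuclideanSpace ℝ (Fin p)) : 0 ≤ Psi 𝓖 γ :=
  Finset.sum_nonneg fun l _ => mul_nonneg (𝓖.w_pos l).le (Real.sqrt_nonneg _)

theorem Psi_smul (c : ℝ) (γ : EuclideanSpace ℝ (Fin p)) : Psi 𝓖 (c • γ) = |c| * Psi 𝓖 γ := by
  simp only [Psi_eq_sum_norm, proj_smul, norm_smul, Finset.mul_sum, Real.norm_eq_abs]
  exact Finset.sum_congr rfl fun l _ => by ring

theorem Psi_zero : Psi 𝓖 0 = 0 := by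
  have := Psi_smul 𝓖 0 0
  simpa using this

theorem Psi_add_le (γ δ : EuclideanSpace ℝ (Fin p)) : Psi 𝓖 (γ + δ) ≤ Psi 𝓖 γ + Psi 𝓖 δ := by
  simp only [Psi_eq_sum_norm, proj_add, ← Finset.sum_add_distrib, ← mul_add]
  exact Finset.sum_le_sum fun l _ => mul_le_mul_of_nonneg_left (norm_add_le _ _) (𝓖.w_pos l).le

theorem sum_groups (f : Fin p → ℝ) : ∑ l, ∑ j ∈ 𝓖.G l, f j = ∑ j, f j := by
  rw [← Finset.sum_biUnion fun k _ l _ h => 𝓖.disjoint h]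
  refine Finset.sum_congr ?_ fun _ _ => rfl
  ext j
  simpa using 𝓖.cover j

theorem le_cP (l : Fin g) : (𝓖.w l)⁻¹ * Real.sqrt ((𝓖.G l).card : ℝ) ≤ cP 𝓖 :=
  le_iSup_finite (fun l => (𝓖.w l)⁻¹ * Real.sqrt ((𝓖.G l).card : ℝ)) l

theorem cP_pos (hp : 0 < p) : 0 < cP 𝓖 := by
  obtain ⟨l, hl⟩ := 𝓖.cover ⟨0, hp⟩
  have hc : 0 < (𝓖.G l).card := Finset.card_pos.2 ⟨_, hl⟩
  have := 𝓖.w_pos l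
  have : 0 < (𝓖.w l)⁻¹ * Real.sqrt ((𝓖.G l).card : ℝ) := by positivity
  exact this.trans_le (le_cP 𝓖 l)

/-- Cauchy–Schwarz within each group. This is where `c_p` enters, as the price of passing from `Ψ`
to the `ℓ₁` norm that the tail bound requires. -/
theorem sum_abs_le_cP_mul_Psi (γ : EuclideanSpace ℝ (Fin p)) : ∑ j, |γ j| ≤ cP 𝓖 * Psi 𝓖 γ := by
  rw [← sum_groups 𝓖, Psi, Finset.mul_sum]
  refine Finset.sum_le_sum fun l _ => ?_
  have cs := Real.sum_mul_le_sqrt_mul_sqrt (𝓖.G l) (fun _ => 1) fun j => |γ j|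
  simp only [one_mul, one_pow, Finset.sum_const, nsmul_eq_mul, mul_one, sq_abs] at cs
  refine cs.trans ?_
  rw [← mul_assoc]
  refine mul_le_mul_of_nonneg_right ?_ (Real.sqrt_nonneg _)
  have hw := 𝓖.w_pos l
  have := mul_le_mul_of_nonneg_right (le_cP 𝓖 l) hw.le
  rwa [mul_right_comm, inv_mul_cancel₀ hw.ne', one_mul] at this

theorem eq_zero_of_Psi_eq_zero {γ : EuclideanSpace ℝ (Fin p)} (h : Psi 𝓖 γ = 0) :
    γ = 0 := by
  have h1 := sum_abs_le_cP_mul_Psi 𝓖 γ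
  rw [h, mul_zero] at h1
  have h2 : ∑ j, |γ j| = 0 := le_antisymm h1 (Finset.sum_nonneg fun _ _ => abs_nonneg _)
  ext j
  simpa using (Finset.sum_eq_zero_iff_of_nonneg fun _ _ => abs_nonneg _).1 h2 j (Finset.mem_univ j)

theorem inner_le_of_abs_le {M : ℝ} (hM : 0 ≤ M) (x y : EuclideanSpace ℝ (Fin p))
    (hy : ∀ j, |y j| ≤ M) : inner ℝ x y ≤ M * cP 𝓖 * Psi 𝓖 x := by
  rw [PiLp.inner_apply]
  calc ∑ j, inner ℝ (x j) (y j) ≤ ∑ j, M * |x j| := by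
        refine Finset.sum_le_sum fun j _ => ?_
        simp only [RCLike.inner_apply, conj_trivial]
        exact (le_abs_self _).trans (by
          rw [abs_mul]; exact mul_le_mul_of_nonneg_right (hy j) (abs_nonneg _))
    _ = M * ∑ j, |x j| := by rw [Finset.mul_sum]
    _ ≤ M * (cP 𝓖 * Psi 𝓖 x) := mul_le_mul_of_nonneg_left (sum_abs_le_cP_mul_Psi 𝓖 x) hM
    _ = _ := by ring

theorem dualPsi_le (hp : 0 < p) {M : ℝ} (hM : 0 ≤ M) (y : EuclideanSpace ℝ (Fin p))
    (hy : ∀ j, |y j| ≤ M) : dualPsi 𝓖 y ≤ cP 𝓖 * M := by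
  refine csSup_le ⟨0, 0, by rw [Psi_zero]; exact zero_le_one, by simp⟩ ?_
  rintro s ⟨x, hx, rfl⟩
  have h := inner_le_of_abs_le 𝓖 hM x y hy
  have h' : M * cP 𝓖 * Psi 𝓖 x ≤ M * cP 𝓖 * 1 :=
    mul_le_mul_of_nonneg_left hx (mul_nonneg hM (cP_pos 𝓖 hp).le)
  linarith

theorem inner_le_dualPsi_mul_Psi (hp : 0 < p) (x y : EuclideanSpace ℝ (Fin p)) :
    inner ℝ x y ≤ dualPsi 𝓖 y * Psi 𝓖 x := by
  rcases (Psi_nonneg 𝓖 x).eq_or_lt with h0 | h0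
  · rw [eq_zero_of_Psi_eq_zero 𝓖 h0.symm, Psi_zero]
    simp
  have hM : ∀ j, |y j| ≤ ‖y‖ := fun j => PiLp.norm_apply_le y j
  -- Needed because `sSup` of a set unbounded above is 0 by convention.
  have hbdd : BddAbove {s : ℝ | ∃ x : EuclideanSpace ℝ (Fin p), Psi 𝓖 x ≤ 1 ∧ s = inner ℝ x y} := by
    refine ⟨‖y‖ * cP 𝓖, ?_⟩
    rintro s ⟨x, hx, rfl⟩
    have h := inner_le_of_abs_le 𝓖 (norm_nonneg y) x y hM
    have h' : ‖y‖ * cP 𝓖 * Psi 𝓖 x ≤ ‖y‖ * cP 𝓖 * 1 :=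
      mul_le_mul_of_nonneg_left hx (mul_nonneg (norm_nonneg y) (cP_pos 𝓖 hp).le)
    linarith
  have h1 : inner ℝ ((Psi 𝓖 x)⁻¹ • x) y ≤ dualPsi 𝓖 y := by
    refine le_csSup hbdd ⟨_, ?_, rfl⟩
    rw [Psi_smul, abs_of_pos (inv_pos.2 h0), inv_mul_cancel₀ h0.ne']
  rw [real_inner_smul_left, inv_mul_eq_div, div_le_iff₀ h0] at h1
  exact h1

end Regularizer

/-! ### Decomposability of the group norm along the active groups. -/

section Support

variable {p g : ℕ} (𝓖 : WeightedGroups p g) (βs : EuclideanSpace ℝ (Fin p))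

theorem mem_expandedSupp_iff {l : Fin g} {j : Fin p} (hj : j ∈ 𝓖.G l) :
    j ∈ expandedSupp 𝓖 βs ↔ l ∈ activeGroups 𝓖 βs := by
  simp only [expandedSupp, Finset.mem_biUnion]
  refine ⟨?_, fun h => ⟨l, h, hj⟩⟩
  rintro ⟨k, hk, hjk⟩
  by_cases e : k = l
  · exact e ▸ hk
  · exact absurd hj (Finset.disjoint_left.1 (𝓖.disjoint e) hjk)

theorem Psi_proj_expandedSupp (γ : EuclideanSpace ℝ (Fin p)) :
    Psi 𝓖 (proj (expandedSupp 𝓖 βs) γ) =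
      ∑ l ∈ activeGroups 𝓖 βs, 𝓖.w l * ‖proj (𝓖.G l) γ‖ := by
  rw [Psi, ← Finset.sum_filter_add_sum_filter_not Finset.univ (· ∈ activeGroups 𝓖 βs)]
  have h2 : ∑ l with l ∉ activeGroups 𝓖 βs,
      𝓖.w l * Real.sqrt (∑ j ∈ 𝓖.G l, proj (expandedSupp 𝓖 βs) γ j ^ 2) = 0 := by
    refine Finset.sum_eq_zero fun l hl => ?_
    rw [Finset.sum_eq_zero fun j hj => ?_, Real.sqrt_zero, mul_zero]
    rw [proj_apply, if_neg]
    · simp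
    · rw [mem_expandedSupp_iff 𝓖 βs hj]
      simpa using hl
  rw [h2, add_zero, Finset.filter_mem_eq_inter, Finset.univ_inter]
  refine Finset.sum_congr rfl fun l hl => ?_
  rw [norm_proj]
  congr 2
  refine Finset.sum_congr rfl fun j hj => ?_
  rw [proj_apply, if_pos ((mem_expandedSupp_iff 𝓖 βs hj).2 hl)]

theorem Psi_proj_compl_expandedSupp (γ : EuclideanSpace ℝ (Fin p)) :
    Psi 𝓖 (proj (expandedSupp 𝓖 βs)ᶜ γ) =
      ∑ l with l ∉ activeGroups 𝓖 βs, 𝓖.w l * ‖proj (𝓖.G l) γ‖ := by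
  rw [Psi, ← Finset.sum_filter_add_sum_filter_not Finset.univ (· ∈ activeGroups 𝓖 βs)]
  have h2 : ∑ l with l ∈ activeGroups 𝓖 βs,
      𝓖.w l * Real.sqrt (∑ j ∈ 𝓖.G l, proj (expandedSupp 𝓖 βs)ᶜ γ j ^ 2) = 0 := by
    refine Finset.sum_eq_zero fun l hl => ?_
    rw [Finset.sum_eq_zero fun j hj => ?_, Real.sqrt_zero, mul_zero]
    rw [proj_apply, if_neg]
    · simp
    · rw [Finset.mem_compl, mem_expandedSupp_iff 𝓖 βs hj]
      simpa using hl
  rw [h2, zero_add]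
  refine Finset.sum_congr rfl fun l hl => ?_
  rw [norm_proj]
  congr 2
  refine Finset.sum_congr rfl fun j hj => ?_
  rw [proj_apply, if_pos]
  rw [Finset.mem_compl, mem_expandedSupp_iff 𝓖 βs hj]
  simpa using hl

theorem Psi_eq_add (γ : EuclideanSpace ℝ (Fin p)) :
    Psi 𝓖 γ = Psi 𝓖 (proj (expandedSupp 𝓖 βs) γ) + Psi 𝓖 (proj (expandedSupp 𝓖 βs)ᶜ γ) := by
  rw [Psi_proj_expandedSupp, Psi_proj_compl_expandedSupp, Psi_eq_sum_norm,
    ← Finset.sum_filter_add_sum_filter_not Finset.univ (· ∈ activeGroups 𝓖 βs)]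
  rw [Finset.filter_mem_eq_inter, Finset.univ_inter]

theorem Psi_proj_expandedSupp_le (γ : EuclideanSpace ℝ (Fin p)) :
    Psi 𝓖 (proj (expandedSupp 𝓖 βs) γ) ≤ cOmega 𝓖 βs * ‖γ‖ := by
  rw [Psi_proj_expandedSupp]
  refine (Real.sum_mul_le_sqrt_mul_sqrt _ _ _).trans ?_
  refine mul_le_mul_of_nonneg_left ?_ (Real.sqrt_nonneg _)
  rw [EuclideanSpace.norm_eq]
  refine Real.sqrt_le_sqrt ?_
  calc ∑ l ∈ activeGroups 𝓖 βs, ‖proj (𝓖.G l) γ‖ ^ 2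
      ≤ ∑ l, ‖proj (𝓖.G l) γ‖ ^ 2 :=
        Finset.sum_le_sum_of_subset_of_nonneg (Finset.subset_univ _) fun _ _ _ => sq_nonneg _
    _ = ∑ l, ∑ j ∈ 𝓖.G l, ‖γ j‖ ^ 2 := by
        refine Finset.sum_congr rfl fun l _ => ?_
        rw [norm_proj, Real.sq_sqrt (Finset.sum_nonneg fun _ _ => sq_nonneg _)]
        simp
    _ = _ := sum_groups 𝓖 fun j => ‖γ j‖ ^ 2

theorem proj_eq_zero_of_notMem_activeGroups {l : Fin g} (hl : l ∉ activeGroups 𝓖 βs) :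
    proj (𝓖.G l) βs = 0 := by
  ext j
  rw [proj_apply]
  split_ifs with hj
  · by_contra h
    refine hl ?_
    simp only [activeGroups, supp, Finset.mem_filter, Finset.mem_univ, true_and]
    exact ⟨j, by simpa [hj] using h⟩
  · rfl

/-- On active groups this is the triangle inequality; on the others `βs` vanishes and the norm of
`γ` is subtracted in full. -/
theorem Psi_sub_Psi_add_le (γ : EuclideanSpace ℝ (Fin p)) :
    Psi 𝓖 βs - Psi 𝓖 (βs + γ) ≤
      Psi 𝓖 (proj (expandedSupp 𝓖 βs) γ) - Psi 𝓖 (proj (expandedSupp 𝓖 βs)ᶜ γ) := by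
  rw [Psi_proj_expandedSupp, Psi_proj_compl_expandedSupp, Psi_eq_sum_norm, Psi_eq_sum_norm,
    ← Finset.sum_sub_distrib,
    ← Finset.sum_filter_add_sum_filter_not Finset.univ (· ∈ activeGroups 𝓖 βs),
    Finset.filter_mem_eq_inter, Finset.univ_inter, sub_eq_add_neg, ← Finset.sum_neg_distrib]
  refine add_le_add (Finset.sum_le_sum fun l _ => ?_) (Finset.sum_le_sum fun l hl => ?_)
  · rw [← mul_sub]
    refine mul_le_mul_of_nonneg_left ?_ (𝓖.w_pos l).le
    rw [proj_add]
    have := norm_sub_le (proj (𝓖.G l) βs + proj (𝓖.G l) γ) (proj (𝓖.G l) γ)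
    rw [add_sub_cancel_right] at this
    linarith
  · rw [proj_add, proj_eq_zero_of_notMem_activeGroups 𝓖 βs (by simpa using hl)]
    simp

theorem cOmega_nonneg : 0 ≤ cOmega 𝓖 βs := Real.sqrt_nonneg _

end Support

/-! ### The excess loss and its convexity. -/

section Loss

variable {n p g : ℕ}

theorem pairMean_mono (hn : 2 ≤ n) {a b : Fin n → Fin n → ℝ} (h : ∀ i j, i ≠ j → a i j ≤ b i j) :
    pairMean a ≤ pairMean b := by
  have hn' : (2 : ℝ) ≤ n := by exact_mod_cast hn
  have : (0 : ℝ) ≤ 1 / ((n : ℝ) * ((n : ℝ) - 1)) :=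
    one_div_nonneg.2 (mul_nonneg (by linarith) (by linarith))
  exact mul_le_mul_of_nonneg_left (Finset.sum_le_sum fun i _ => Finset.sum_le_sum fun j hj =>
    h i j (Finset.ne_of_mem_erase hj).symm) this

theorem pairMean_sub (a b : Fin n → Fin n → ℝ) :
    pairMean (fun i j => a i j - b i j) = pairMean a - pairMean b := by
  simp only [pairMean, Finset.sum_sub_distrib, mul_sub]

theorem pairMean_const_mul (c : ℝ) (a : Fin n → Fin n → ℝ) :
    pairMean (fun i j => c * a i j) = c * pairMean a := by
  simp only [pairMean, ← Finset.mul_sum]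
  ring

/-- The excess rank loss at `γ`, the increment of the loss from the true coefficient vector. -/
noncomputable def excess (X : Matrix (Fin n) (Fin p) ℝ) (e : Fin n → ℝ)
    (γ : EuclideanSpace ℝ (Fin p)) : ℝ :=
  rankLoss (X *ᵥ γ.ofLp - e) - rankLoss (-e)

/-- The difference `(Xᵢ - Xⱼ)ᵀ γ`. -/
def rowDiff (X : Matrix (Fin n) (Fin p) ℝ) (γ : EuclideanSpace ℝ (Fin p)) (i j : Fin n) : ℝ :=
  (fun q => X i q - X j q) ⬝ᵥ γ.ofLp

theorem rowDiff_eq (X : Matrix (Fin n) (Fin p) ℝ) (γ : EuclideanSpace ℝ (Fin p)) (i j : Fin n) :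
    rowDiff X γ i j = (X *ᵥ γ.ofLp) i - (X *ᵥ γ.ofLp) j := by
  rw [rowDiff, Matrix.mulVec, Matrix.mulVec, ← sub_dotProduct]
  rfl

theorem abs_rowDiff_le (X : Matrix (Fin n) (Fin p) ℝ) {b₁ : ℝ} (hX : ∀ i j, |X i j| ≤ b₁)
    (γ : EuclideanSpace ℝ (Fin p)) (i j : Fin n) :
    |rowDiff X γ i j| ≤ 2 * b₁ * ∑ q, |γ q| := by
  rw [rowDiff, dotProduct, Finset.mul_sum]
  refine (Finset.abs_sum_le_sum_abs _ _).trans (Finset.sum_le_sum fun q _ => ?_)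
  rw [abs_mul]
  refine mul_le_mul_of_nonneg_right ?_ (abs_nonneg _)
  have := abs_sub (X i q) (X j q)
  linarith [hX i q, hX j q]

theorem excess_eq_pairMean (X : Matrix (Fin n) (Fin p) ℝ) (e : Fin n → ℝ)
    (γ : EuclideanSpace ℝ (Fin p)) :
    excess X e γ =
      pairMean fun i j => |(e i - e j) - rowDiff X γ i j| - |e i - e j| := by
  rw [pairMean_sub, excess, rankLoss, rankLoss, pairMean, pairMean]
  congr 3 <;> funext i <;> refine Finset.sum_congr rfl fun j _ => ?_
  · rw [rowDiff_eq, abs_sub_comm, Pi.sub_apply, Pi.sub_apply]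
    congr 1
    ring
  · rw [Pi.neg_apply, Pi.neg_apply, abs_sub_comm]
    congr 1
    ring

theorem rowDiff_smul (X : Matrix (Fin n) (Fin p) ℝ) (c : ℝ) (γ : EuclideanSpace ℝ (Fin p))
    (i j : Fin n) : rowDiff X (c • γ) i j = c * rowDiff X γ i j := by
  simp [rowDiff]

/-- Convexity along a ray, together with zero excess at the origin. -/
theorem excess_smul_le (hn : 2 ≤ n) (X : Matrix (Fin n) (Fin p) ℝ) (e : Fin n → ℝ)
    (γ : EuclideanSpace ℝ (Fin p)) {c : ℝ} (h0 : 0 ≤ c) (h1 : c ≤ 1) :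
    excess X e (c • γ) ≤ c * excess X e γ := by
  rw [excess_eq_pairMean, excess_eq_pairMean, ← pairMean_const_mul]
  refine pairMean_mono hn fun i j _ => ?_
  rw [rowDiff_smul]
  have h := abs_add_le ((1 - c) * (e i - e j)) (c * ((e i - e j) - rowDiff X γ i j))
  rw [abs_mul, abs_mul, abs_of_nonneg h0, abs_of_nonneg (by linarith : 0 ≤ 1 - c)] at h
  have : (1 - c) * (e i - e j) + c * ((e i - e j) - rowDiff X γ i j) =
      (e i - e j) - c * rowDiff X γ i j := by ring
  rw [this] at h
  linarith

theorem IsEstimator.excess_le (𝓖 : WeightedGroups p g) (X : Matrix (Fin n) (Fin p) ℝ)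
    (βs b : EuclideanSpace ℝ (Fin p)) (e : Fin n → ℝ) (lam : ℝ)
    (h : IsEstimator 𝓖 X (X *ᵥ βs.ofLp + e) lam b) :
    excess X e (b - βs) ≤ lam * (Psi 𝓖 βs - Psi 𝓖 (βs + (b - βs))) := by
  have h1 := h (Set.mem_univ βs)
  simp only [Set.mem_ofPred_eq] at h1
  have e1 : X *ᵥ βs.ofLp - (X *ᵥ βs.ofLp + e) = -e := by abel
  have e2 : X *ᵥ b.ofLp - (X *ᵥ βs.ofLp + e) = X *ᵥ (b - βs).ofLp - e := by
    rw [WithLp.ofLp_sub, Matrix.mulVec_sub]; abel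
  rw [e1, e2] at h1
  rw [excess, add_sub_cancel]
  linarith

/-- The excess loss inequality of an estimator carries over to smaller multiples of the error. -/
theorem excess_smul_le_of_excess_le (hn : 2 ≤ n) (𝓖 : WeightedGroups p g)
    (X : Matrix (Fin n) (Fin p) ℝ) (βs γ : EuclideanSpace ℝ (Fin p)) (e : Fin n → ℝ) {lam : ℝ}
    (hlam : 0 ≤ lam) (h : excess X e γ ≤ lam * (Psi 𝓖 βs - Psi 𝓖 (βs + γ)))
    {c : ℝ} (h0 : 0 ≤ c) (h1 : c ≤ 1) :
    excess X e (c • γ) ≤ lam * (Psi 𝓖 βs - Psi 𝓖 (βs + c • γ)) := by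
  have hc := excess_smul_le hn X e γ h0 h1
  have hΨ : Psi 𝓖 (βs + c • γ) ≤ (1 - c) * Psi 𝓖 βs + c * Psi 𝓖 (βs + γ) := by
    have := Psi_add_le 𝓖 ((1 - c) • βs) (c • (βs + γ))
    rw [Psi_smul, Psi_smul, abs_of_nonneg h0, abs_of_nonneg (by linarith : 0 ≤ 1 - c)] at this
    convert this using 2
    module
  have h2 := mul_le_mul_of_nonneg_left hΨ hlam
  have h3 := mul_le_mul_of_nonneg_left h h0
  linarith

end Loss

/-! ### The subgradient at zero and the cone condition. -/

section Score

variable {n p g : ℕ}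

/-- The sum of the signs of `eᵢ - eₖ` over `k`, which is the centred rank of `eᵢ`. -/
noncomputable def signSum (e : Fin n → ℝ) (i : Fin n) : ℝ :=
  ∑ k, (SignType.sign (e i - e k) : ℝ)

/-- A subgradient of the excess loss at zero. -/
noncomputable def score (X : Matrix (Fin n) (Fin p) ℝ) (e : Fin n → ℝ) :
    EuclideanSpace ℝ (Fin p) :=
  WithLp.toLp 2 ((-(2 / ((n : ℝ) * ((n : ℝ) - 1)))) • (Xᵀ *ᵥ signSum e))

/-- Antisymmetry of the sign merges the two halves of the row difference. In this form the score can
be compared with the excess term by term, and the U-statistic tail bound applies to it. -/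
theorem inner_score (X : Matrix (Fin n) (Fin p) ℝ) (e : Fin n → ℝ)
    (γ : EuclideanSpace ℝ (Fin p)) :
    inner ℝ γ (score X e) =
      pairMean fun i j => -(rowDiff X γ i j * (SignType.sign (e i - e j) : ℝ)) := by
  have h1 : inner ℝ γ (score X e) =
      -(2 / ((n : ℝ) * ((n : ℝ) - 1))) * ((X *ᵥ γ.ofLp) ⬝ᵥ signSum e) := by
    rw [EuclideanSpace.inner_eq_star_dotProduct, score]
    simp only [star_trivial, smul_dotProduct, smul_eq_mul]
    rw [Matrix.mulVec_transpose, ← Matrix.dotProduct_mulVec, dotProduct_comm]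
  have h2 : ∑ i, ∑ j ∈ Finset.univ.erase i,
      -(rowDiff X γ i j * (SignType.sign (e i - e j) : ℝ)) =
      ∑ i, ∑ j, -(rowDiff X γ i j * (SignType.sign (e i - e j) : ℝ)) := by
    refine Finset.sum_congr rfl fun i _ => ?_
    refine Finset.sum_subset (Finset.erase_subset _ _) fun j _ hj => ?_
    have : j = i := by simpa using hj
    subst this
    simp
  have h3 : ∑ i, ∑ j, (X *ᵥ γ.ofLp) j * (SignType.sign (e i - e j) : ℝ) =
      -∑ i, ∑ j, (X *ᵥ γ.ofLp) i * (SignType.sign (e i - e j) : ℝ) := by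
    rw [Finset.sum_comm, ← Finset.sum_neg_distrib]
    refine Finset.sum_congr rfl fun i _ => ?_
    rw [← Finset.sum_neg_distrib]
    refine Finset.sum_congr rfl fun j _ => ?_
    rw [← neg_sub (e i) (e j), Left.sign_neg]
    simp
  rw [h1, pairMean, h2]
  simp only [rowDiff_eq, sub_mul, neg_sub, Finset.sum_sub_distrib]
  rw [h3]
  simp only [dotProduct, signSum, Finset.mul_sum]
  rw [← Finset.sum_neg_distrib, ← Finset.sum_sub_distrib, Finset.mul_sum]
  refine Finset.sum_congr rfl fun i _ => ?_
  rw [← Finset.mul_sum]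
  ring

/-- For every pair, `-t sign z ≤ |z - t| - |z|`. -/
theorem inner_score_le_excess (hn : 2 ≤ n) (X : Matrix (Fin n) (Fin p) ℝ) (e : Fin n → ℝ)
    (γ : EuclideanSpace ℝ (Fin p)) : inner ℝ γ (score X e) ≤ excess X e γ := by
  rw [inner_score, excess_eq_pairMean]
  refine pairMean_mono hn fun i j _ => ?_
  set z := e i - e j
  set t := rowDiff X γ i j
  rcases lt_trichotomy z 0 with h | h | h
  · rw [sign_neg h, abs_of_neg h]
    have := neg_abs_le (z - t)
    simp
    linarith
  · simp [h]
  · rw [sign_pos h, abs_of_pos h]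
    have := le_abs_self (z - t)
    simp
    linarith

/-- The cone condition for the estimation error. -/
theorem Psi_compl_le_of_excess_le (hn : 2 ≤ n) (hp : 0 < p) (𝓖 : WeightedGroups p g)
    (X : Matrix (Fin n) (Fin p) ℝ) (βs γ : EuclideanSpace ℝ (Fin p)) (e : Fin n → ℝ)
    {c₀ lam : ℝ} (hc₀ : 1 < c₀) (hlam : 0 < lam) (hdual : c₀ * dualPsi 𝓖 (score X e) ≤ lam)
    (h : excess X e γ ≤ lam * (Psi 𝓖 βs - Psi 𝓖 (βs + γ))) :
    Psi 𝓖 (proj (expandedSupp 𝓖 βs)ᶜ γ) ≤ (cBar c₀ - 1) * Psi 𝓖 (proj (expandedSupp 𝓖 βs) γ) := by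
  have h1 := inner_score_le_excess hn X e γ
  have h2 := inner_le_dualPsi_mul_Psi 𝓖 hp (-γ) (score X e)
  have h3 : Psi 𝓖 (-γ) = Psi 𝓖 γ := by
    have := Psi_smul 𝓖 (-1) γ
    simpa using this
  rw [inner_neg_left, h3] at h2
  have h4 := mul_le_mul_of_nonneg_left (Psi_sub_Psi_add_le 𝓖 βs γ) hlam.le
  have h5 := mul_le_mul_of_nonneg_right hdual (Psi_nonneg 𝓖 γ)
  have h6 := Psi_eq_add 𝓖 βs γ
  set P := Psi 𝓖 (proj (expandedSupp 𝓖 βs) γ)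
  set Q := Psi 𝓖 (proj (expandedSupp 𝓖 βs)ᶜ γ)
  rw [h6] at h5 h2
  -- After division by `lam` this reads `(c₀ - 1) Q ≤ (c₀ + 1) P`, and the ratio of the two factors
  -- is `c̄ - 1`.
  have h7 : c₀ * (lam * (Q - P)) ≤ lam * (P + Q) := by
    have : lam * (Q - P) ≤ dualPsi 𝓖 (score X e) * (P + Q) := by linarith
    have := mul_le_mul_of_nonneg_left this (by linarith : 0 ≤ c₀)
    linarith
  have h8 : c₀ * (Q - P) ≤ P + Q := by
    have : lam * (c₀ * (Q - P)) ≤ lam * (P + Q) := by linarith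
    exact le_of_mul_le_mul_left this hlam
  rw [cBar, add_sub_cancel_left, div_mul_eq_mul_div, le_div_iff₀ (by linarith)]
  linarith

end Score

/-! ### Quantiles over the permutations. -/

section Quantile

variable {n : ℕ}

theorem le_card_le_permQuantile (Z : Equiv.Perm (Fin n) → ℝ) {u : ℝ} (hu1 : u ≤ 1) :
    u ≤ (Nat.card {σ : Equiv.Perm (Fin n) // Z σ ≤ permQuantile Z u} : ℝ) /
      (Nat.card (Equiv.Perm (Fin n)) : ℝ) := by
  set A := {t : ℝ | u ≤ (Nat.card {σ : Equiv.Perm (Fin n) // Z σ ≤ t} : ℝ) /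
    (Nat.card (Equiv.Perm (Fin n)) : ℝ)} with hA
  have hne : A.Nonempty := by
    refine ⟨⨆ σ, Z σ, ?_⟩
    have : Nat.card {σ : Equiv.Perm (Fin n) // Z σ ≤ ⨆ σ, Z σ} =
        Nat.card (Equiv.Perm (Fin n)) :=
      Nat.card_congr (Equiv.subtypeUnivEquiv fun σ => le_iSup_finite Z σ)
    rw [hA, Set.mem_ofPred_eq, this, div_self (by simp)]
    exact hu1
  have hq : permQuantile Z u = sInf A := rfl
  set q := permQuantile Z u
  -- `Z` takes finitely many values, so none lies just above `q`; hence the infimum is attained.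
  obtain ⟨δ, hδ, hgap⟩ : ∃ δ > 0, ∀ σ, q < Z σ → q + δ ≤ Z σ := by
    by_cases h : ∃ σ, q < Z σ
    · obtain ⟨σ₀, h₀, hmin⟩ := (Set.toFinite {σ | q < Z σ}).exists_minimalFor Z _ h
      refine ⟨Z σ₀ - q, sub_pos.2 h₀, fun σ hσ => ?_⟩
      rcases le_total (Z σ₀) (Z σ) with h' | h'
      · linarith
      · linarith [hmin hσ h']
    · exact ⟨1, one_pos, fun σ hσ => absurd ⟨σ, hσ⟩ h⟩
  obtain ⟨t, ht, htq⟩ := exists_lt_of_csInf_lt hne (show sInf A < q + δ by linarith)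
  refine (show u ≤ _ from ht).trans ?_
  gcongr
  refine Nat.card_le_card_of_injective (Subtype.impEmbedding _ _ ?_) (Subtype.impEmbedding _ _ _).injective
  intro σ hσ
  by_contra h
  have := hgap σ (not_le.1 h)
  linarith

theorem permQuantile_le (Z : Equiv.Perm (Fin n) → ℝ) {u t : ℝ} (hu : 0 < u)
    (ht : u ≤ (Nat.card {σ : Equiv.Perm (Fin n) // Z σ ≤ t} : ℝ) /
      (Nat.card (Equiv.Perm (Fin n)) : ℝ)) : permQuantile Z u ≤ t := by
  -- Below the least value of `Z` the proportion is `0 < u`, which gives the lower bound that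
  -- `csInf_le` requires.
  refine csInf_le ⟨⨅ σ, Z σ, fun x hx => ?_⟩ ht
  by_contra h
  have : IsEmpty {σ : Equiv.Perm (Fin n) // Z σ ≤ x} := ⟨fun σ =>
    h ((ciInf_le (Set.finite_range Z).bddBelow σ.1).trans σ.2)⟩
  have hx' : u ≤ (Nat.card {σ : Equiv.Perm (Fin n) // Z σ ≤ x} : ℝ) /
    (Nat.card (Equiv.Perm (Fin n)) : ℝ) := hx
  rw [Nat.card_of_isEmpty] at hx'
  simp at hx'
  linarith

end Quantile

/-! ### Uniform ranks and the law of the score. -/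

section Ranks

variable {n p : ℕ}

/-- `σ` lists the ranks of the coordinates of `e`, which has no ties. -/
def IsRanking (σ : Equiv.Perm (Fin n)) (e : Fin n → ℝ) : Prop := ∀ i j, σ i < σ j → e i < e j

/-- The number of smaller indices minus the number of larger ones. Indices start at 0, so the value
is `2 (a + 1) - (n + 1)`, as in `xi`. -/
theorem sum_sign_sub (a : Fin n) :
    ∑ m : Fin n, (SignType.sign (((a : ℕ) : ℝ) - ((m : ℕ) : ℝ)) : ℝ) =
      2 * ((a : ℕ) : ℝ) + 1 - n := by
  have h : ∀ m : Fin n, (SignType.sign (((a : ℕ) : ℝ) - ((m : ℕ) : ℝ)) : ℝ) =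
      (if m < a then 1 else 0) + (if m ≤ a then 1 else 0) - 1 := by
    intro m
    rcases lt_trichotomy m a with h | h | h
    · have : ((m : ℕ) : ℝ) < ((a : ℕ) : ℝ) := by exact_mod_cast h
      rw [sign_pos (by linarith), if_pos h, if_pos h.le]; simp
    · subst h; simp
    · have : ((a : ℕ) : ℝ) < ((m : ℕ) : ℝ) := by exact_mod_cast h
      rw [sign_neg (by linarith), if_neg h.not_gt, if_neg h.not_ge]; simp
  rw [Finset.sum_congr rfl fun m _ => h m]
  simp only [Finset.sum_sub_distrib, Finset.sum_add_distrib, Finset.sum_boole, Finset.sum_const,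
    Finset.card_univ, Fintype.card_fin, nsmul_eq_mul, mul_one]
  have h1 : (Finset.univ.filter fun m : Fin n => m < a).card = a := by
    rw [← Fin.card_Iio a]; congr 1; ext m; simp
  have h2 : (Finset.univ.filter fun m : Fin n => m ≤ a).card = a + 1 := by
    rw [← Fin.card_Iic a]; congr 1; ext m; simp
  rw [h1, h2]
  push_cast
  ring

theorem IsRanking.signSum_eq {σ : Equiv.Perm (Fin n)} {e : Fin n → ℝ} (h : IsRanking σ e) :
    signSum e = xi σ := by
  funext i
  have h1 : ∀ k, (SignType.sign (e i - e k) : ℝ) =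
      (SignType.sign (((σ i : ℕ) : ℝ) - ((σ k : ℕ) : ℝ)) : ℝ) := by
    intro k
    rcases lt_trichotomy (σ k) (σ i) with hk | hk | hk
    · have : ((σ k : ℕ) : ℝ) < ((σ i : ℕ) : ℝ) := by exact_mod_cast hk
      rw [sign_pos (sub_pos.2 (h _ _ hk)), sign_pos (sub_pos.2 this)]
    · rw [σ.injective hk]; simp
    · have : ((σ i : ℕ) : ℝ) < ((σ k : ℕ) : ℝ) := by exact_mod_cast hk
      rw [sign_neg (sub_neg.2 (h _ _ hk)), sign_neg (sub_neg.2 this)]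
  rw [signSum, Finset.sum_congr rfl fun k _ => h1 k,
    Equiv.sum_comp σ fun m => (SignType.sign (((σ i : ℕ) : ℝ) - ((m : ℕ) : ℝ)) : ℝ),
    sum_sign_sub, xi]
  ring

theorem IsRanking.score_eq {σ : Equiv.Perm (Fin n)} {e : Fin n → ℝ} (h : IsRanking σ e)
    (X : Matrix (Fin n) (Fin p) ℝ) : score X e = Sn X σ := by
  rw [score, Sn, h.signSum_eq]

theorem IsRanking.unique {σ τ : Equiv.Perm (Fin n)} {e : Fin n → ℝ} (h : IsRanking σ e)
    (h' : IsRanking τ e) : σ = τ := by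
  have := h.signSum_eq.symm.trans h'.signSum_eq
  ext i
  have hi := congrFun this i
  simp only [xi] at hi
  have : ((σ i : ℕ) : ℝ) = ((τ i : ℕ) : ℝ) := by linarith
  exact_mod_cast this

theorem exists_isRanking {e : Fin n → ℝ} (he : e.Injective) : ∃ σ, IsRanking σ e := by
  refine ⟨(Tuple.sort e)⁻¹, fun i j hij => ?_⟩
  have hmono := (Tuple.monotone_sort e).strictMono_of_injective
    (he.comp (Tuple.sort e).injective)
  simpa using hmono hij

theorem isRanking_iff_comp_symm (σ : Equiv.Perm (Fin n)) (e : Fin n → ℝ) :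
    IsRanking σ e ↔ IsRanking 1 fun i => e (σ.symm i) := by
  constructor
  · intro h i j hij
    exact h _ _ (by simpa using hij)
  · intro h i j hij
    simpa using h (σ i) (σ j) (by simpa using hij)

theorem measurableSet_isRanking (σ : Equiv.Perm (Fin n)) :
    MeasurableSet {e : Fin n → ℝ | IsRanking σ e} := by
  have : {e : Fin n → ℝ | IsRanking σ e} = ⋂ i, ⋂ j, ⋂ (_ : σ i < σ j), {e | e i < e j} := by
    ext e; simp [IsRanking]
  rw [this]
  exact MeasurableSet.iInter fun i => MeasurableSet.iInter fun j => MeasurableSet.iInter fun _ =>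
    measurableSet_lt (measurable_pi_apply i) (measurable_pi_apply j)

variable {S : Type*} [MeasurableSpace S] (μ : Measure S) [IsProbabilityMeasure μ]
  (ε : Fin n → S → ℝ)

/-- Exchangeability of i.i.d. errors. -/
theorem measure_isRanking_eq (hε : ∀ i, Measurable (ε i)) (hind : iIndepFun ε μ)
    (hlaw : ∀ i j, μ.map (ε i) = μ.map (ε j)) (σ : Equiv.Perm (Fin n)) :
    μ {ω | IsRanking σ fun i => ε i ω} = μ {ω | IsRanking 1 fun i => ε i ω} := by
  have hm : ∀ τ : Equiv.Perm (Fin n), Measurable fun ω i => ε (τ i) ω := fun τ =>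
    measurable_pi_lambda _ fun i => hε _
  have hmap : μ.map (fun ω i => ε (σ.symm i) ω) = μ.map (fun ω i => ε i ω) := by
    rw [(iIndepFun_iff_map_fun_eq_pi_map fun i => (hε i).aemeasurable).1 hind,
      (iIndepFun_iff_map_fun_eq_pi_map fun i => (hε _).aemeasurable).1
        (hind.precomp σ.symm.injective)]
    congr 1
    funext i
    exact hlaw _ _
  have h1 : {ω | IsRanking σ fun i => ε i ω} =
      (fun ω i => ε (σ.symm i) ω) ⁻¹' {e | IsRanking 1 e} := by
    ext ω
    exact isRanking_iff_comp_symm σ _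
  have h2 : {ω | IsRanking (1 : Equiv.Perm (Fin n)) fun i => ε i ω} =
      (fun ω i => ε i ω) ⁻¹' {e | IsRanking 1 e} := rfl
  rw [h1, h2, ← Measure.map_apply (hm σ.symm) (measurableSet_isRanking 1), hmap,
    Measure.map_apply (measurable_pi_lambda _ hε) (measurableSet_isRanking 1)]

/-- The law of the score is that of `Sn` for a uniformly distributed permutation. -/
theorem measureReal_score (hε : ∀ i, Measurable (ε i)) (hind : iIndepFun ε μ)
    (hlaw : ∀ i j, μ.map (ε i) = μ.map (ε j))
    (hties : ∀ i j, i ≠ j → ∀ᵐ ω ∂μ, ε i ω ≠ ε j ω) (X : Matrix (Fin n) (Fin p) ℝ)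
    (B : EuclideanSpace ℝ (Fin p) → Prop) :
    μ.real {ω | B (score X fun i => ε i ω)} =
      (Nat.card {σ : Equiv.Perm (Fin n) // B (Sn X σ)} : ℝ) /
        (Nat.card (Equiv.Perm (Fin n)) : ℝ) := by
  classical
  have hinj : ∀ᵐ ω ∂μ, Function.Injective fun i => ε i ω := by
    have : ∀ᵐ ω ∂μ, ∀ i j, i ≠ j → ε i ω ≠ ε j ω := by
      rw [ae_all_iff]; intro i
      rw [ae_all_iff]; intro j
      by_cases h : i = j
      · simp [h]
      · simpa [h] using hties i j h
    filter_upwards [this] with ω hω i j hij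
    by_contra h
    exact hω i j h hij
  have hmeas : ∀ σ : Equiv.Perm (Fin n), MeasurableSet {ω | IsRanking σ fun i => ε i ω} :=
    fun σ => measurableSet_preimage (measurable_pi_lambda _ hε) (measurableSet_isRanking σ)
  have key : ∀ C : EuclideanSpace ℝ (Fin p) → Prop, μ.real {ω | C (score X fun i => ε i ω)} =
      (Nat.card {σ : Equiv.Perm (Fin n) // C (Sn X σ)} : ℝ) *
        μ.real {ω | IsRanking 1 fun i => ε i ω} := by
    intro C
    have hae : {ω | C (score X fun i => ε i ω)} =ᵐ[μ]
        ⋃ σ ∈ Finset.univ.filter (fun σ : Equiv.Perm (Fin n) => C (Sn X σ)),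
          {ω | IsRanking σ fun i => ε i ω} := by
      filter_upwards [hinj] with ω hω
      obtain ⟨σ, hσ⟩ := exists_isRanking hω
      apply propext
      change C (score X fun i => ε i ω) ↔ ω ∈ ⋃ σ ∈ Finset.univ.filter
        (fun σ : Equiv.Perm (Fin n) => C (Sn X σ)), {ω | IsRanking σ fun i => ε i ω}
      simp only [Set.mem_iUnion, Finset.mem_filter, Finset.mem_univ, true_and, exists_prop,
        Set.mem_ofPred_eq]
      constructor
      · intro h
        exact ⟨σ, by rwa [← hσ.score_eq X], hσ⟩
      · rintro ⟨τ, hτ, hτ'⟩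
        rwa [hτ'.score_eq X]
    rw [measureReal_congr hae, measureReal_biUnion_finset]
    · rw [Finset.sum_congr rfl fun σ _ => by
        rw [measureReal_def, measure_isRanking_eq μ ε hε hind hlaw σ, ← measureReal_def]]
      rw [Finset.sum_const, nsmul_eq_mul, Nat.card_eq_fintype_card, Fintype.card_subtype]
    · intro σ _ τ _ hne
      rw [Function.onFun, Set.disjoint_left]
      intro ω h h'
      exact hne (IsRanking.unique h h')
    · exact fun σ _ => hmeas σ
  -- The trivial event identifies the common probability of a ranking as `1 / n!`.
  have htot := key fun _ => True
  have hcard : Nat.card {_σ : Equiv.Perm (Fin n) // True} = Nat.card (Equiv.Perm (Fin n)) :=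
    Nat.card_congr (Equiv.subtypeUnivEquiv fun _ => trivial)
  rw [hcard] at htot
  have h1 : {ω : S | True} = Set.univ := by ext; simp
  rw [h1, probReal_univ] at htot
  rw [key B, div_eq_mul_inv, ← eq_inv_of_mul_eq_one_right htot.symm]

end Ranks

theorem const_mul_dotProduct_eq {n p : ℕ} (X : Matrix (Fin n) (Fin p) ℝ) (c : ℝ)
    (γ : EuclideanSpace ℝ (Fin p)) (i j : Fin n) :
    (fun q => c * (X i q - X j q)) ⬝ᵥ γ.ofLp = c * rowDiff X γ i j := by
  simp only [rowDiff, dotProduct, Finset.mul_sum, mul_assoc]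

/-! ### Size of the simulated penalty. -/

section Penalty

variable {n p g : ℕ} {S : Type*} [MeasurableSpace S] (μ : Measure S) [IsProbabilityMeasure μ]
  (ε : Fin n → S → ℝ)

theorem measureReal_dualPsi_score_le_quantile (hε : ∀ i, Measurable (ε i)) (hind : iIndepFun ε μ)
    (hlaw : ∀ i j, μ.map (ε i) = μ.map (ε j))
    (hties : ∀ i j, i ≠ j → ∀ᵐ ω ∂μ, ε i ω ≠ ε j ω) (X : Matrix (Fin n) (Fin p) ℝ)
    (𝓖 : WeightedGroups p g) {u : ℝ} (hu1 : u ≤ 1) :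
    u ≤ μ.real {ω | dualPsi 𝓖 (score X fun i => ε i ω) ≤
      permQuantile (fun σ => dualPsi 𝓖 (Sn X σ)) u} := by
  rw [measureReal_score μ ε hε hind hlaw hties X
    (fun y => dualPsi 𝓖 y ≤ permQuantile (fun σ => dualPsi 𝓖 (Sn X σ)) u)]
  exact le_card_le_permQuantile _ hu1

/-- The coordinates of the score, with both signs, are its inner products with the vectors `± e_j`,
whose `ℓ₁` norm is 1. Symmetry of the differences allows the sign version of domination, with `c =
1`. -/
theorem measureReal_score_large_le (hn : 2 ≤ n) (hp : 0 < p) (hε : ∀ i, Measurable (ε i))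
    (hind : iIndepFun ε μ)
    (hsymm : ∀ i j, i ≠ j → μ.map (fun ω => ε i ω - ε j ω) = μ.map fun ω => ε j ω - ε i ω)
    (X : Matrix (Fin n) (Fin p) ℝ) {b₁ : ℝ} (hb₁ : 0 < b₁) (hX : ∀ i j, |X i j| ≤ b₁)
    {M : ℝ} (hM : 0 < M) :
    μ.real {ω | ∃ j, M ≤ |score X (fun i => ε i ω) j|} ≤
      2 * p * Real.exp (-(n * M ^ 2 / (24 * b₁ ^ 2))) := by
  have : Nonempty (Fin p) := ⟨⟨0, hp⟩⟩
  let v : Fin p × Bool → EuclideanSpace ℝ (Fin p) := fun x =>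
    EuclideanSpace.single x.1 (if x.2 then 1 else -1)
  have hv : ∀ x, ∑ j, |v x j| ≤ 1 := by
    rintro ⟨q, b⟩
    rw [Finset.sum_eq_single q]
    · cases b <;> simp [v]
    · intro j _ hj; simp [v, hj]
    · simp
  have tail := measure_pairMean_ge_le μ hn hp X hb₁ hX ε hε hind (fun x => (v x).ofLp) one_pos hv
    one_pos (fun i j x z => -(rowDiff X (v x) i j * (SignType.sign z : ℝ)))
    (fun i j x => ((measurable_sign_real.const_mul _).neg)) ?_ hM
  · have hsub : {ω | ∃ j, M ≤ |score X (fun i => ε i ω) j|} ⊆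
        {ω | ∃ x, M ≤ pairMean fun i j =>
          -(rowDiff X (v x) i j * (SignType.sign (ε i ω - ε j ω) : ℝ))} := by
      rintro ω ⟨j, hj⟩
      have hin : ∀ b, inner ℝ (v (j, b)) (score X fun i => ε i ω) =
          (if b then 1 else -1) * score X (fun i => ε i ω) j := by
        intro b
        simp only [v]
        rw [EuclideanSpace.inner_single_left]
        cases b <;> simp
      rcases le_abs.1 hj with h | h
      · refine ⟨(j, true), ?_⟩
        rw [← inner_score X (fun i => ε i ω), hin]
        simpa using h
      · refine ⟨(j, false), ?_⟩
        rw [← inner_score X (fun i => ε i ω), hin]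
        simpa using h
    have h2 := (measure_mono hsub).trans tail
    rw [one_mul, one_mul] at h2
    exact ENNReal.toReal_le_of_le_ofReal (by positivity) h2
  · intro i j hij s hs
    have hWm : Measurable fun ω => ε i ω - ε j ω := (hε i).sub (hε j)
    have : IsProbabilityMeasure (μ.map fun ω => ε i ω - ε j ω) :=
      Measure.isProbabilityMeasure_map hWm.aemeasurable
    have hs' : (μ.map fun ω => ε i ω - ε j ω).map (fun z => -z) =
        μ.map fun ω => ε i ω - ε j ω := by
      rw [Measure.map_map measurable_neg hWm, hsymm i j hij]
      congr 1
      funext ω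
      simp
    have := signDominated_sign (μ.map fun ω => ε i ω - ε j ω) hs'
      fun x : Fin p × Bool => s * rowDiff X (v x) i j
    convert this using 1
    · funext x z; ring
    · funext x
      rw [one_mul, const_mul_dotProduct_eq]

theorem lambdaStar_le (hn : 2 ≤ n) (hε : ∀ i, Measurable (ε i))
    (hind : iIndepFun ε μ) (hlaw : ∀ i j, μ.map (ε i) = μ.map (ε j))
    (hties : ∀ i j, i ≠ j → ∀ᵐ ω ∂μ, ε i ω ≠ ε j ω)
    (hsymm : ∀ i j, i ≠ j → μ.map (fun ω => ε i ω - ε j ω) = μ.map fun ω => ε j ω - ε i ω)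
    (X : Matrix (Fin n) (Fin p) ℝ) {b₁ : ℝ} (hb₁ : 0 < b₁) (hX : ∀ i j, |X i j| ≤ b₁)
    (𝓖 : WeightedGroups p g) {c₀ α₀ : ℝ} (hc₀ : 0 < c₀) (hα₀ : 0 < α₀) (hα₀' : α₀ < 1)
    (hp : 2 / α₀ ≤ (p : ℝ)) :
    lambdaStar 𝓖 X c₀ α₀ ≤ c₀ * (cP 𝓖 * (7 * b₁ * Real.sqrt (Real.log p / n))) := by
  have hp2 : (2 : ℝ) < p := by
    refine lt_of_lt_of_le ?_ hp
    rw [lt_div_iff₀ hα₀]; linarith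
  have hp0 : 0 < p := by exact_mod_cast (by linarith : (0 : ℝ) < p)
  have hlog : 0 < Real.log p := Real.log_pos (by linarith)
  have hn0 : (0 : ℝ) < n := by exact_mod_cast (by omega : 0 < n)
  -- Since `7² / 24 > 2`, the tail is at most `2 p · p⁻² = 2 / p ≤ α₀`.
  set M := 7 * b₁ * Real.sqrt (Real.log p / n) with hMdef
  have hM : 0 < M := by have := Real.sqrt_pos.2 (div_pos hlog hn0); positivity
  refine mul_le_mul_of_nonneg_left (permQuantile_le _ (by linarith) ?_) hc₀.le
  rw [← measureReal_score μ ε hε hind hlaw hties X fun y => dualPsi 𝓖 y ≤ cP 𝓖 * M]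
  have hlarge := measureReal_score_large_le μ ε hn hp0 hε hind hsymm X hb₁ hX hM
  have hbound : 2 * p * Real.exp (-(n * M ^ 2 / (24 * b₁ ^ 2))) ≤ α₀ := by
    have h1 : n * M ^ 2 / (24 * b₁ ^ 2) = 49 / 24 * Real.log p := by
      rw [hMdef, mul_pow, Real.sq_sqrt (by positivity)]
      field_simp
      ring
    calc 2 * p * Real.exp (-(n * M ^ 2 / (24 * b₁ ^ 2)))
        ≤ 2 * p * Real.exp (-(Real.log p + Real.log p)) := by
          rw [h1]
          refine mul_le_mul_of_nonneg_left (Real.exp_le_exp.2 (by linarith)) (by positivity)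
      _ = 2 / p := by
          rw [Real.exp_neg, Real.exp_add, Real.exp_log (by linarith)]
          field_simp
      _ ≤ α₀ := by
          rw [div_le_iff₀ (by linarith)]
          rw [div_le_iff₀ hα₀] at hp
          linarith
  have hcover : (Set.univ : Set S) ⊆ {ω | dualPsi 𝓖 (score X fun i => ε i ω) ≤ cP 𝓖 * M} ∪
      {ω | ∃ j, M ≤ |score X (fun i => ε i ω) j|} := by
    intro ω _
    by_cases h : ∃ j, M ≤ |score X (fun i => ε i ω) j|
    · exact Or.inr h
    · refine Or.inl (dualPsi_le 𝓖 hp0 hM.le _ fun j => ?_)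
      push Not at h
      exact (h j).le
  have h3 := (measureReal_mono (μ := μ) hcover).trans (measureReal_union_le _ _)
  rw [probReal_univ] at h3
  linarith

end Penalty

/-! ### Quadratic growth of the mean absolute deviation. -/

section MeanShift

/-- The expected increment of the absolute deviation when the centre moves from `0` to `t`. -/
noncomputable def meanShift (P : Measure ℝ) (t : ℝ) : ℝ := ∫ z, (|z - t| - |z|) ∂P

theorem abs_shift_le (z t : ℝ) : |(|z - t| - |z|)| ≤ |t| := by
  have := abs_abs_sub_abs_le_abs_sub (z - t) z
  simpa using this

theorem abs_shift_sub_le (z s t : ℝ) : |(|z - s| - |z|) - (|z - t| - |z|)| ≤ |s - t| := by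
  have := abs_abs_sub_abs_le_abs_sub (z - s) (z - t)
  rw [sub_sub_sub_cancel_right]
  refine this.trans (le_of_eq ?_)
  rw [abs_sub_comm s t]
  congr 1
  ring

theorem measurable_shift (t : ℝ) : Measurable fun z : ℝ => |z - t| - |z| := by
  have : Continuous fun z : ℝ => |z - t| - |z| := by fun_prop
  exact this.measurable

variable (P : Measure ℝ) [IsProbabilityMeasure P]

theorem integrable_shift (t : ℝ) : Integrable (fun z => |z - t| - |z|) P :=
  Integrable.of_bound (measurable_shift t).aestronglyMeasurable |t|
    (Filter.Eventually.of_forall fun z => abs_shift_le z t)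

theorem continuous_meanShift : Continuous (meanShift P) := by
  refine (LipschitzWith.of_dist_le_mul (K := 1) fun s t => ?_).continuous
  rw [NNReal.coe_one, one_mul, Real.dist_eq, Real.dist_eq, meanShift, meanShift,
    ← integral_sub (integrable_shift P s) (integrable_shift P t)]
  have := norm_integral_le_of_norm_le_const (μ := P) (C := |s - t|)
    (f := fun z => (|z - s| - |z|) - (|z - t| - |z|))
    (Filter.Eventually.of_forall fun z => abs_shift_sub_le z s t)
  simpa using this

theorem integral_tent {a : ℝ} (ha : 0 ≤ a) : ∫ z in (-a)..a, (a - |z|) = a ^ 2 := by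
  have hint : ∀ u v : ℝ, IntervalIntegrable (fun z : ℝ => a - |z|) volume u v := fun u v =>
    (by fun_prop : Continuous fun z : ℝ => a - |z|).intervalIntegrable u v
  rw [← intervalIntegral.integral_add_adjacent_intervals (hint (-a) 0) (hint 0 a)]
  have h1 : ∫ z in (-a)..0, (a - |z|) = ∫ z in (-a)..0, (a + z) :=
    intervalIntegral.integral_congr fun z hz => by
      rw [Set.uIcc_of_le (by linarith)] at hz
      simp only [abs_of_nonpos hz.2]; ring
  have h2 : ∫ z in (0)..a, (a - |z|) = ∫ z in (0)..a, (a - z) :=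
    intervalIntegral.integral_congr fun z hz => by
      rw [Set.uIcc_of_le ha] at hz
      simp only [abs_of_nonneg hz.1]
  rw [h1, h2, intervalIntegral.integral_add (by simp) (by simp),
    intervalIntegral.integral_sub (by simp) (by simp)]
  simp
  ring

/-- Averaging over `z` and `-z` turns the integrand into the tent `max (|t| - |z|) 0`. Its Lebesgue
integral is `t²`, and the density is at least `b` on its support. -/
theorem mul_sq_le_meanShift (hsymm : P.map (fun z => -z) = P) {f : ℝ → ℝ}
    (hdens : P = (volume : Measure ℝ).withDensity fun t => ENNReal.ofReal (f t))
    (hf : Measurable f) {b t : ℝ} (hb : 0 < b) (hbf : ∀ z, |z| ≤ |t| → b ≤ f z) :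
    b * t ^ 2 ≤ meanShift P t := by
  have hpos : ∀ z, 0 ≤ max (|t| - |z|) 0 := fun z => le_max_right _ _
  have hmeas : Measurable fun z : ℝ => max (|t| - |z|) 0 :=
    (by fun_prop : Continuous fun z : ℝ => max (|t| - |z|) 0).measurable
  have hle : ∀ z : ℝ, max (|t| - |z|) 0 ≤ |t| := fun z =>
    max_le (by linarith [abs_nonneg z]) (abs_nonneg t)
  have hint : Integrable (fun z : ℝ => max (|t| - |z|) 0) P :=
    Integrable.of_bound hmeas.aestronglyMeasurable |t| (Filter.Eventually.of_forall fun z => by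
      rw [Real.norm_of_nonneg (hpos z)]; exact hle z)
  have hmean : meanShift P t = ∫ z, max (|t| - |z|) 0 ∂P := by
    have hneg : meanShift P t = ∫ z, (|-z - t| - |-z|) ∂P := by
      rw [meanShift]
      conv_lhs => rw [← hsymm]
      rw [integral_map measurable_neg.aemeasurable (measurable_shift t).aestronglyMeasurable]
    have hint' : Integrable (fun z => |-z - t| - |-z|) P :=
      Integrable.of_bound ((measurable_shift t).comp measurable_neg).aestronglyMeasurable |t|
        (Filter.Eventually.of_forall fun z => abs_shift_le (-z) t)
    have h2 : meanShift P t + meanShift P t = ∫ z, 2 * max (|t| - |z|) 0 ∂P := by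
      nth_rewrite 2 [hneg]
      rw [meanShift, ← integral_add (integrable_shift P t) hint']
      congr 1
      funext z
      have e : |-z - t| = |z + t| := by rw [← abs_neg]; congr 1; ring
      rw [e, abs_neg]
      rcases abs_cases z with ⟨e1, _⟩ | ⟨e1, _⟩ <;> rcases abs_cases t with ⟨e2, _⟩ | ⟨e2, _⟩ <;>
        rcases abs_cases (z - t) with ⟨e3, _⟩ | ⟨e3, _⟩ <;>
        rcases abs_cases (z + t) with ⟨e4, _⟩ | ⟨e4, _⟩ <;>
        rcases max_cases (|t| - |z|) 0 with ⟨e5, _⟩ | ⟨e5, _⟩ <;> linarith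
    rw [integral_const_mul] at h2
    linarith
  rw [hmean]
  have hlow : ENNReal.ofReal (b * t ^ 2) ≤ ∫⁻ z, ENNReal.ofReal (max (|t| - |z|) 0) ∂P := by
    rw [hdens, lintegral_withDensity_eq_lintegral_mul _ (by fun_prop) hmeas.ennreal_ofReal]
    calc ENNReal.ofReal (b * t ^ 2)
        = ENNReal.ofReal b * ∫⁻ z in Set.Ioc (-|t|) |t|, ENNReal.ofReal (|t| - |z|) := by
          rw [ENNReal.ofReal_mul hb.le, ← sq_abs, ← integral_tent (abs_nonneg t),
            intervalIntegral.integral_of_le (by linarith [abs_nonneg t]),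
            ofReal_integral_eq_lintegral_ofReal]
          · exact (by fun_prop : Continuous fun z : ℝ => |t| - |z|).integrableOn_Ioc
          · filter_upwards [ae_restrict_mem measurableSet_Ioc] with z hz
            exact sub_nonneg.2 (abs_le.2 ⟨hz.1.le, hz.2⟩)
      _ = ∫⁻ z in Set.Ioc (-|t|) |t|, ENNReal.ofReal b * ENNReal.ofReal (|t| - |z|) := by
          rw [lintegral_const_mul' _ _ (by simp)]
      _ ≤ ∫⁻ z in Set.Ioc (-|t|) |t|, ((fun t => ENNReal.ofReal (f t)) *
            fun z => ENNReal.ofReal (max (|t| - |z|) 0)) z := by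
          refine setLIntegral_mono' measurableSet_Ioc fun z hz => ?_
          simp only [Pi.mul_apply]
          exact mul_le_mul' (ENNReal.ofReal_le_ofReal (hbf z (abs_le.2 ⟨hz.1.le, hz.2⟩)))
            (ENNReal.ofReal_le_ofReal (le_max_left _ _))
      _ ≤ _ := setLIntegral_le_lintegral _ _
  rw [← ofReal_integral_eq_lintegral_ofReal hint (Filter.Eventually.of_forall hpos)] at hlow
  exact (ENNReal.ofReal_le_ofReal_iff (integral_nonneg hpos)).1 hlow

end MeanShift

/-! ### Restricted eigenvalues and squared row differences. -/

section Curvature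

variable {n p g : ℕ}

theorem pairMean_sq_sub (hn : 2 ≤ n) (a : Fin n → ℝ) (ha : ∑ i, a i = 0) :
    pairMean (fun i j => (a i - a j) ^ 2) = 2 / ((n : ℝ) - 1) * ∑ i, a i ^ 2 := by
  have hn' : (2 : ℝ) ≤ n := by exact_mod_cast hn
  have h1 : ∑ i, ∑ j ∈ Finset.univ.erase i, (a i - a j) ^ 2 = ∑ i, ∑ j, (a i - a j) ^ 2 := by
    refine Finset.sum_congr rfl fun i _ => ?_
    refine Finset.sum_subset (Finset.erase_subset _ _) fun j _ hj => ?_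
    have : j = i := by simpa using hj
    subst this
    simp
  have h2 : ∑ i, ∑ j, (a i - a j) ^ 2 = 2 * n * ∑ i, a i ^ 2 := by
    have h3 : ∀ i, ∑ j, (a i - a j) ^ 2 = n * a i ^ 2 + ∑ j, a j ^ 2 := by
      intro i
      have : ∀ j, (a i - a j) ^ 2 = a i ^ 2 + a j ^ 2 - 2 * a i * a j := fun j => by ring
      rw [Finset.sum_congr rfl fun j _ => this j, Finset.sum_sub_distrib, Finset.sum_add_distrib,
        ← Finset.mul_sum, ha]
      simp
    rw [Finset.sum_congr rfl fun i _ => h3 i, Finset.sum_add_distrib, ← Finset.mul_sum]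
    simp
    ring
  have h0 : (n : ℝ) ≠ 0 := by linarith
  have h0' : (n : ℝ) - 1 ≠ 0 := by linarith
  rw [pairMean, h1, h2]
  field_simp

/-- Centred columns make the fitted values sum to zero, so their squared differences average to `2 /
(n - 1)` times the sum of squares; `n / (n - 1) ≥ 1` does the rest. -/
theorem le_pairMean_sq_rowDiff (hn : 2 ≤ n) (𝓖 : WeightedGroups p g)
    (X : Matrix (Fin n) (Fin p) ℝ) (hX : ∀ j, ∑ i, X i j = 0) (βs γ : EuclideanSpace ℝ (Fin p))
    {c₀ b₂ : ℝ} (hb₂ : 0 < b₂) (hRE : RestrictedEigenvalue 𝓖 X βs c₀ b₂) (hγ : γ ≠ 0)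
    (hcone : Psi 𝓖 (proj (expandedSupp 𝓖 βs)ᶜ γ) ≤
      (cBar c₀ - 1) * Psi 𝓖 (proj (expandedSupp 𝓖 βs) γ)) :
    2 * b₂ * ‖γ‖ ^ 2 ≤ pairMean fun i j => rowDiff X γ i j ^ 2 := by
  have hn' : (2 : ℝ) ≤ n := by exact_mod_cast hn
  have hγ' : 0 < ‖γ‖ := norm_pos_iff.2 hγ
  have hsum : ∑ i, (X *ᵥ γ.ofLp) i = 0 := by
    simp only [Matrix.mulVec, dotProduct]
    rw [Finset.sum_comm]
    refine Finset.sum_eq_zero fun j _ => ?_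
    rw [← Finset.sum_mul, hX, zero_mul]
  have h := hRE γ hγ hcone
  rw [le_div_iff₀ (by positivity), ← Matrix.mulVec_mulVec, Matrix.dotProduct_mulVec,
    ← Matrix.mulVec_transpose, Matrix.transpose_transpose] at h
  have hsq : (X *ᵥ γ.ofLp) ⬝ᵥ (X *ᵥ γ.ofLp) = ∑ i, (X *ᵥ γ.ofLp) i ^ 2 :=
    Finset.sum_congr rfl fun i _ => (sq _).symm
  rw [hsq] at h
  simp only [rowDiff_eq]
  rw [pairMean_sq_sub hn _ hsum, div_mul_eq_mul_div, le_div_iff₀ (by linarith)]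
  have : 0 ≤ b₂ * ‖γ‖ ^ 2 := by positivity
  nlinarith

end Curvature

/-! ### Uniform deviation of the excess loss. -/

section Deviation

variable {n p : ℕ} {S : Type*} [MeasurableSpace S] (μ : Measure S) [IsProbabilityMeasure μ]
  (ε : Fin n → S → ℝ)

/-- The expected excess loss at `γ`, as a function of the laws of the differences of the errors. -/
noncomputable def meanExcess (X : Matrix (Fin n) (Fin p) ℝ) (γ : EuclideanSpace ℝ (Fin p)) : ℝ :=
  pairMean fun i j => meanShift (μ.map fun ω => ε i ω - ε j ω) (rowDiff X γ i j)

theorem continuous_rowDiff (X : Matrix (Fin n) (Fin p) ℝ) (i j : Fin n) :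
    Continuous fun γ => rowDiff X γ i j := by
  unfold rowDiff dotProduct
  fun_prop

theorem continuous_meanExcess (hε : ∀ i, Measurable (ε i)) (X : Matrix (Fin n) (Fin p) ℝ) :
    Continuous (meanExcess μ ε X) := by
  unfold meanExcess pairMean
  refine continuous_const.mul (continuous_finsetSum _ fun i _ => continuous_finsetSum _ fun j _ => ?_)
  have : IsProbabilityMeasure (μ.map fun ω => ε i ω - ε j ω) :=
    Measure.isProbabilityMeasure_map ((hε i).sub (hε j)).aemeasurable
  exact (continuous_meanShift _).comp (continuous_rowDiff X i j)

theorem continuous_excess (X : Matrix (Fin n) (Fin p) ℝ) (e : Fin n → ℝ) :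
    Continuous (excess X e) := by
  have : excess X e = fun γ =>
      pairMean fun i j => |(e i - e j) - rowDiff X γ i j| - |e i - e j| :=
    funext fun γ => excess_eq_pairMean X e γ
  rw [this]
  unfold pairMean
  refine continuous_const.mul (continuous_finsetSum _ fun i _ => continuous_finsetSum _ fun j _ => ?_)
  exact ((continuous_const.sub (continuous_rowDiff X i j)).abs).sub continuous_const

/-- The map `t ↦ |z - t| - |z|` is 1-Lipschitz and vanishes at 0, so the centred terms are dominated
by twice the linear ones; this is the `2` in the exponent. -/
theorem measure_finite_deviation_le {ι : Type*} [Finite ι] [Nonempty ι] (hn : 2 ≤ n) (hp : 0 < p)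
    (hε : ∀ i, Measurable (ε i)) (hind : iIndepFun ε μ)
    (X : Matrix (Fin n) (Fin p) ℝ) {b₁ : ℝ} (hb₁ : 0 < b₁) (hX : ∀ i j, |X i j| ≤ b₁)
    (v : ι → EuclideanSpace ℝ (Fin p)) {ρ : ℝ} (hρ : 0 < ρ) (hv : ∀ x, ∑ q, |v x q| ≤ ρ)
    {T : ℝ} (hT : 0 < T) :
    μ {ω | ∃ x, T ≤ meanExcess μ ε X (v x) - excess X (fun i => ε i ω) (v x)} ≤
      ENNReal.ofReal (2 * p * Real.exp (-(n * T ^ 2 / (24 * (2 * ρ * b₁) ^ 2)))) := by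
  have tail := measure_pairMean_ge_le μ hn hp X hb₁ hX ε hε hind (fun x => (v x).ofLp) hρ hv
    two_pos (fun i j x z => meanShift (μ.map fun ω => ε i ω - ε j ω) (rowDiff X (v x) i j) -
      (|z - rowDiff X (v x) i j| - |z|))
    (fun i j x => (measurable_shift _).const_sub _) ?_ hT
  · refine le_trans (le_of_eq ?_) tail
    congr 1
    ext ω
    simp only [excess_eq_pairMean, meanExcess, pairMean_sub]
  · intro i j hij s hs
    have : IsProbabilityMeasure (μ.map fun ω => ε i ω - ε j ω) :=
      Measure.isProbabilityMeasure_map ((hε i).sub (hε j)).aemeasurable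
    have := signDominated_of_lipschitz (μ.map fun ω => ε i ω - ε j ω)
      (fun x z => s * (|z - rowDiff X (v x) i j| - |z|)) (fun x => s * rowDiff X (v x) i j)
      (fun x => (measurable_shift _).const_mul _) ?_ ?_
    · convert this using 1
      · funext x z
        rw [integral_const_mul, meanShift]
        ring
      · funext x
        rw [const_mul_dotProduct_eq, mul_assoc]
    · intro z x y
      rw [← mul_sub, ← mul_sub, abs_mul, abs_mul]
      exact mul_le_mul_of_nonneg_left (abs_shift_sub_le _ _ _) (abs_nonneg _)
    · intro z x
      rw [abs_mul, abs_mul]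
      exact mul_le_mul_of_nonneg_left (abs_shift_le _ _) (abs_nonneg _)

/-- Uniform one-sided deviation of the excess loss from its mean over an `ℓ₁`-bounded set. -/
theorem measure_deviation_le (hn : 2 ≤ n) (hp : 0 < p)
    (hε : ∀ i, Measurable (ε i)) (hind : iIndepFun ε μ)
    (X : Matrix (Fin n) (Fin p) ℝ) {b₁ : ℝ} (hb₁ : 0 < b₁) (hX : ∀ i j, |X i j| ≤ b₁)
    (K : Set (EuclideanSpace ℝ (Fin p))) {ρ : ℝ} (hρ : 0 < ρ) (hK : ∀ γ ∈ K, ∑ q, |γ q| ≤ ρ)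
    {T : ℝ} (hT : 0 < T) :
    μ {ω | ∃ γ ∈ K, T < meanExcess μ ε X γ - excess X (fun i => ε i ω) γ} ≤
      ENNReal.ofReal (2 * p * Real.exp (-(n * T ^ 2 / (24 * (2 * ρ * b₁) ^ 2)))) := by
  rcases K.eq_empty_or_nonempty with rfl | hne
  · simp
  have := hne.to_subtype
  -- The finite bound does not depend on the number of indices, so it passes to an increasing union.
  -- Continuity in `γ` and the strict inequality make the failure set open in `K`, hence visible on
  -- a dense sequence.
  set d : ℕ → K := TopologicalSpace.denseSeq K
  set A : ℕ → Set S := fun N => {ω | ∃ x : Fin (N + 1),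
    T ≤ meanExcess μ ε X (d x) - excess X (fun i => ε i ω) (d x)} with hA
  have hmono : Monotone A := by
    rintro M N hMN ω ⟨x, hx⟩
    exact ⟨⟨x, by omega⟩, hx⟩
  have hsub : {ω | ∃ γ ∈ K, T < meanExcess μ ε X γ - excess X (fun i => ε i ω) γ} ⊆ ⋃ N, A N := by
    rintro ω ⟨γ, hγ, hlt⟩
    have hopen : IsOpen {δ : K | T < meanExcess μ ε X δ - excess X (fun i => ε i ω) δ} :=
      isOpen_lt continuous_const (((continuous_meanExcess μ ε hε X).sub
        (continuous_excess X _)).comp continuous_subtype_val)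
    obtain ⟨N, hN⟩ := (TopologicalSpace.denseRange_denseSeq K).exists_mem_open hopen
      ⟨⟨γ, hγ⟩, hlt⟩
    exact Set.mem_iUnion.2 ⟨N, ⟨N, by omega⟩, le_of_lt hN⟩
  refine (measure_mono hsub).trans ?_
  rw [hmono.measure_iUnion]
  exact iSup_le fun N => measure_finite_deviation_le μ ε hn hp hε hind X hb₁ hX
    (fun x : Fin (N + 1) => (d x : EuclideanSpace ℝ (Fin p))) hρ (fun x => hK _ (d x).2) hT

end Deviation

/-! ### Localization to the cone at norm `R`. -/

section ErrorBound

variable {n p g : ℕ}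

theorem two_le_cBar {c₀ : ℝ} (hc₀ : 1 < c₀) : 2 ≤ cBar c₀ := by
  have : 1 ≤ (c₀ + 1) / (c₀ - 1) := by
    rw [le_div_iff₀ (by linarith)]; linarith
  rw [cBar]; linarith

theorem rate_pos (hn : 0 < n) (hp : (1 : ℝ) < p) : 0 < rate n p := by
  have hn0 : (0 : ℝ) < n := by exact_mod_cast hn
  have := div_pos (Real.log_pos hp) hn0
  exact add_pos this (Real.sqrt_pos.2 this)

theorem sqrt_le_rate (hp : (1 : ℝ) < p) : Real.sqrt (Real.log p / n) ≤ rate n p := by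
  have := (Real.log_pos hp).le
  rw [rate]
  have : 0 ≤ Real.log p / n := by positivity
  linarith

theorem log_le_mul_rate_sq (hn : 0 < n) (hp : (1 : ℝ) < p) :
    Real.log p ≤ n * rate n p ^ 2 := by
  have hn0 : (0 : ℝ) < n := by exact_mod_cast hn
  have h0 := (Real.log_pos hp).le
  have h := pow_le_pow_left₀ (Real.sqrt_nonneg _) (sqrt_le_rate (n := n) hp) 2
  rw [Real.sq_sqrt (by positivity), div_le_iff₀ hn0] at h
  linarith

/-- The exponent is `27 / 8` times `n 𝓔²`. As `2 p ≤ p²` and `log p ≤ n 𝓔²`, the prefactor consumes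
at most two units of it, and more than one remains. -/
theorem two_mul_exp_le (hn : 0 < n) (hp : (2 : ℝ) < p) {ρ b : ℝ} (hρ : 0 < ρ) (hb : 0 < b) :
    2 * p * Real.exp (-(n * (18 * b * ρ * rate n p) ^ 2 / (24 * (2 * ρ * b) ^ 2))) ≤
      Real.exp (-((n : ℝ) * rate n p ^ 2)) := by
  have hlog := log_le_mul_rate_sq hn (show (1 : ℝ) < p by linarith)
  have h1 : n * (18 * b * ρ * rate n p) ^ 2 / (24 * (2 * ρ * b) ^ 2) =
      27 / 8 * (n * rate n p ^ 2) := by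
    field_simp
    ring
  have h2 : (2 : ℝ) * p ≤ Real.exp (Real.log p + Real.log p) := by
    rw [Real.exp_add, Real.exp_log (by linarith)]
    nlinarith
  have h3 : 0 ≤ Real.log p := Real.log_nonneg (by linarith)
  rw [h1]
  calc 2 * p * Real.exp (-(27 / 8 * (n * rate n p ^ 2)))
      ≤ Real.exp (Real.log p + Real.log p) * Real.exp (-(27 / 8 * (n * rate n p ^ 2))) :=
        mul_le_mul_of_nonneg_right h2 (Real.exp_pos _).le
    _ = Real.exp (Real.log p + Real.log p + -(27 / 8 * (n * rate n p ^ 2))) :=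
        (Real.exp_add _ _).symm
    _ ≤ _ := Real.exp_le_exp.2 (by linarith)

/-- The vectors of norm `R` in the cone of the restricted eigenvalue condition. -/
def coneSphere (𝓖 : WeightedGroups p g) (βs : EuclideanSpace ℝ (Fin p)) (c₀ R : ℝ) :
    Set (EuclideanSpace ℝ (Fin p)) :=
  {γ | ‖γ‖ = R ∧ Psi 𝓖 (proj (expandedSupp 𝓖 βs)ᶜ γ) ≤
    (cBar c₀ - 1) * Psi 𝓖 (proj (expandedSupp 𝓖 βs) γ)}

theorem Psi_le_of_cone (𝓖 : WeightedGroups p g) (βs γ : EuclideanSpace ℝ (Fin p)) {c₀ : ℝ}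
    (hc₀ : 1 < c₀) (hcone : Psi 𝓖 (proj (expandedSupp 𝓖 βs)ᶜ γ) ≤
      (cBar c₀ - 1) * Psi 𝓖 (proj (expandedSupp 𝓖 βs) γ)) :
    Psi 𝓖 γ ≤ cBar c₀ * (cOmega 𝓖 βs * ‖γ‖) := by
  have h1 := mul_le_mul_of_nonneg_left (Psi_proj_expandedSupp_le 𝓖 βs γ)
    (by linarith [two_le_cBar hc₀] : 0 ≤ cBar c₀)
  rw [Psi_eq_add 𝓖 βs γ]
  linarith

theorem sum_abs_le_of_mem_coneSphere (hp : 0 < p) (𝓖 : WeightedGroups p g)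
    (βs : EuclideanSpace ℝ (Fin p)) {c₀ R : ℝ} (hc₀ : 1 < c₀) {γ : EuclideanSpace ℝ (Fin p)}
    (hγ : γ ∈ coneSphere 𝓖 βs c₀ R) :
    ∑ q, |γ q| ≤ cP 𝓖 * (cBar c₀ * (cOmega 𝓖 βs * R)) := by
  have h := mul_le_mul_of_nonneg_left (Psi_le_of_cone 𝓖 βs γ hc₀ hγ.2) (cP_pos 𝓖 hp).le
  rw [hγ.1] at h
  exact (sum_abs_le_cP_mul_Psi 𝓖 γ).trans h

/-- An estimation error outside the ball of radius `R` yields a point of the cone at distance `R`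
with small excess loss. -/
theorem exists_mem_coneSphere_of_lt (hn : 2 ≤ n) (𝓖 : WeightedGroups p g)
    (X : Matrix (Fin n) (Fin p) ℝ) (βs γ : EuclideanSpace ℝ (Fin p)) (e : Fin n → ℝ)
    {c₀ lam R : ℝ} (hlam : 0 ≤ lam) (hR : 0 ≤ R)
    (h : excess X e γ ≤ lam * (Psi 𝓖 βs - Psi 𝓖 (βs + γ)))
    (hcone : Psi 𝓖 (proj (expandedSupp 𝓖 βs)ᶜ γ) ≤
      (cBar c₀ - 1) * Psi 𝓖 (proj (expandedSupp 𝓖 βs) γ)) (hlt : R < ‖γ‖) :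
    ∃ δ ∈ coneSphere 𝓖 βs c₀ R, excess X e δ ≤ lam * (cOmega 𝓖 βs * R) := by
  have hγ : 0 < ‖γ‖ := hR.trans_lt hlt
  have hc0 : 0 ≤ R / ‖γ‖ := by positivity
  have hc1 : R / ‖γ‖ ≤ 1 := (div_le_one hγ).2 hlt.le
  have hnorm : ‖(R / ‖γ‖) • γ‖ = R := by
    rw [norm_smul, Real.norm_of_nonneg hc0, div_mul_cancel₀ _ hγ.ne']
  refine ⟨(R / ‖γ‖) • γ, ⟨hnorm, ?_⟩, ?_⟩
  · rw [proj_smul, proj_smul, Psi_smul, Psi_smul, abs_of_nonneg hc0, mul_left_comm]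
    exact mul_le_mul_of_nonneg_left hcone hc0
  · refine (excess_smul_le_of_excess_le hn 𝓖 X βs γ e hlam h hc0 hc1).trans ?_
    refine mul_le_mul_of_nonneg_left ?_ hlam
    have h1 := Psi_sub_Psi_add_le 𝓖 βs ((R / ‖γ‖) • γ)
    have h2 := Psi_nonneg 𝓖 (proj (expandedSupp 𝓖 βs)ᶜ ((R / ‖γ‖) • γ))
    have h3 := Psi_proj_expandedSupp_le 𝓖 βs ((R / ‖γ‖) • γ)
    rw [hnorm] at h3
    linarith

variable {S : Type*} [MeasurableSpace S] (μ : Measure S) [IsProbabilityMeasure μ]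
  (ε : Fin n → S → ℝ)

theorem le_meanExcess (hn : 2 ≤ n) (hp : 0 < p) (hε : ∀ i, Measurable (ε i))
    (𝓖 : WeightedGroups p g) (X : Matrix (Fin n) (Fin p) ℝ) (hXcent : ∀ j, ∑ i, X i j = 0)
    {b₁ b₂ b₃ c₀ R : ℝ} (hX : ∀ i j, |X i j| ≤ b₁) (hb₁ : 0 < b₁) (hb₂ : 0 < b₂) (hb₃ : 0 < b₃)
    (hc₀ : 1 < c₀) (hR : 0 < R) (βs : EuclideanSpace ℝ (Fin p))
    (hRE : RestrictedEigenvalue 𝓖 X βs c₀ b₂) (f : ℝ → ℝ)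
    (hdens : ∀ i j, i ≠ j → HasDensity μ (fun s => ε i s - ε j s) f)
    (hf : ∀ z, |z| ≤ 2 * b₁ * (cP 𝓖 * (cBar c₀ * (cOmega 𝓖 βs * R))) → b₃ ≤ f z)
    {γ : EuclideanSpace ℝ (Fin p)} (hγ : γ ∈ coneSphere 𝓖 βs c₀ R) :
    b₃ * (2 * b₂ * R ^ 2) ≤ meanExcess μ ε X γ := by
  have hγ0 : γ ≠ 0 := norm_pos_iff.1 (hγ.1.symm ▸ hR)
  have h1 := le_pairMean_sq_rowDiff hn 𝓖 X hXcent βs γ hb₂ hRE hγ0 hγ.2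
  rw [hγ.1] at h1
  refine (mul_le_mul_of_nonneg_left h1 hb₃.le).trans ?_
  rw [← pairMean_const_mul, meanExcess]
  refine pairMean_mono hn fun i j hij => ?_
  have hW : Measurable fun ω => ε i ω - ε j ω := (hε i).sub (hε j)
  have : IsProbabilityMeasure (μ.map fun ω => ε i ω - ε j ω) :=
    Measure.isProbabilityMeasure_map hW.aemeasurable
  refine mul_sq_le_meanShift _ ?_ (hdens i j hij).2.2 (hdens i j hij).1 hb₃ fun z hz => ?_
  · rw [Measure.map_map measurable_neg hW, (hdens i j hij).2.2, ← (hdens j i hij.symm).2.2]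
    congr 1
    funext ω
    simp
  · refine hf z (hz.trans ((abs_rowDiff_le X hX γ i j).trans ?_))
    exact mul_le_mul_of_nonneg_left (sum_abs_le_of_mem_coneSphere hp 𝓖 βs hc₀ hγ) (by positivity)

end ErrorBound

end RankLasso

/-! ### The error bound. -/

open RankLasso in
theorem theorem1 {S : Type*} [MeasurableSpace S] (μ : Measure S) [IsProbabilityMeasure μ]
    (n p g : ℕ) (hn : 2 ≤ n)
    (𝓖 : RankLasso.WeightedGroups p g)
    (X : Matrix (Fin n) (Fin p) ℝ)
    (βs : EuclideanSpace ℝ (Fin p))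
    (ε : Fin n → S → ℝ)
    (c₀ α₀ b₁ b₂ b₃ : ℝ)
    (hc₀ : 1 < c₀) (hα₀ : 0 < α₀) (hα₀' : α₀ < 1)
    (hb₁ : 0 < b₁) (hb₂ : 0 < b₂) (hb₃ : 0 < b₃)
    -- design matrix condition
    (hXcent : ∀ j, ∑ i, X i j = 0)
    (hXbdd : ∀ i j, |X i j| ≤ b₁)
    (hRE : RankLasso.RestrictedEigenvalue 𝓖 X βs c₀ b₂)
    -- error distribution condition
    (f fstar : ℝ → ℝ)
    (hεmeas : ∀ i, Measurable (ε i))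
    (hεindep : iIndepFun ε μ)
    (hεdens : ∀ i, RankLasso.HasDensity μ (ε i) f)
    (hζdens : ∀ i j, i ≠ j → RankLasso.HasDensity μ (fun s => ε i s - ε j s) fstar)
    (hfstar : ∀ z : ℝ,
      |z| ≤ 68 * b₁ ^ 2 * c₀ * RankLasso.cBar c₀ ^ 2 / (b₂ * b₃) * RankLasso.cP 𝓖 ^ 2 *
        RankLasso.cOmega 𝓖 βs ^ 2 * RankLasso.rate n p →
      b₃ ≤ fstar z)
    (hp : 2 / α₀ ≤ (p : ℝ))
    -- the regularization parameter of the estimator is positive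
    (hlam : 0 < RankLasso.lambdaStar 𝓖 X c₀ α₀)
    -- any estimator computed from the responses of the linear model
    (βhat : S → EuclideanSpace ℝ (Fin p))
    (hβhat : ∀ᵐ s ∂μ, RankLasso.IsEstimator 𝓖 X (X *ᵥ βs.ofLp + fun i => ε i s)
      (RankLasso.lambdaStar 𝓖 X c₀ α₀) (βhat s)) :
    1 - Real.exp (-((n : ℝ) * RankLasso.rate n p ^ 2)) - α₀ ≤
      μ.real {s | ‖βhat s - βs‖ ≤ 34 * b₁ * c₀ * RankLasso.cBar c₀ / (b₂ * b₃) *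
        RankLasso.cOmega 𝓖 βs * RankLasso.cP 𝓖 * RankLasso.rate n p} := by
  have hp2 : (2 : ℝ) < p := by
    refine lt_of_lt_of_le ?_ hp
    rw [lt_div_iff₀ hα₀]; linarith
  have hp0 : 0 < p := by exact_mod_cast (by linarith : (0 : ℝ) < p)
  have hn0 : 0 < n := by omega
  have hlaw : ∀ i j, μ.map (ε i) = μ.map (ε j) := fun i j =>
    (hεdens i).2.2.trans (hεdens j).2.2.symm
  have hsymm : ∀ i j, i ≠ j → μ.map (fun ω => ε i ω - ε j ω) = μ.map fun ω => ε j ω - ε i ω :=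
    fun i j hij => (hζdens i j hij).2.2.trans (hζdens j i hij.symm).2.2.symm
  have hties : ∀ i j, i ≠ j → ∀ᵐ ω ∂μ, ε i ω ≠ ε j ω := by
    intro i j hij
    have hnull : (μ.map fun ω => ε i ω - ε j ω) {0} = 0 := by
      rw [(hζdens i j hij).2.2]
      exact withDensity_absolutelyContinuous _ _ (by simp)
    have hW : Measurable fun ω => ε i ω - ε j ω := (hεmeas i).sub (hεmeas j)
    rw [Measure.map_apply hW (measurableSet_singleton 0)] at hnull
    refine measure_mono_null ?_ hnull
    intro ω hω
    simpa [sub_eq_zero] using hω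
  set lam := lambdaStar 𝓖 X c₀ α₀ with hlamdef
  set R := 34 * b₁ * c₀ * cBar c₀ / (b₂ * b₃) * cOmega 𝓖 βs * cP 𝓖 * rate n p with hRdef
  have hcBar := two_le_cBar hc₀
  have hrate := rate_pos (n := n) (p := p) hn0 (by linarith)
  have hcP := cP_pos 𝓖 hp0
  have hcΩ := cOmega_nonneg 𝓖 βs
  have hR0 : 0 ≤ R := by
    have : 0 < cBar c₀ := by linarith
    have : 0 < c₀ := by linarith
    positivity
  set ρ := cP 𝓖 * (cBar c₀ * (cOmega 𝓖 βs * R)) with hρdef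
  set good := {ω | dualPsi 𝓖 (score X fun i => ε i ω) ≤
    permQuantile (fun σ => dualPsi 𝓖 (Sn X σ)) (1 - α₀)} with hgood
  set bad := {ω | ∃ γ ∈ coneSphere 𝓖 βs c₀ R,
    18 * b₁ * ρ * rate n p < meanExcess μ ε X γ - excess X (fun i => ε i ω) γ} with hbad
  have hPgood : 1 - α₀ ≤ μ.real good :=
    measureReal_dualPsi_score_le_quantile μ ε hεmeas hεindep hlaw hties X 𝓖 (by linarith)
  have hlamle := lambdaStar_le μ ε hn hεmeas hεindep hlaw hties hsymm X hb₁ hXbdd 𝓖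
    (by linarith : 0 < c₀) hα₀ hα₀' hp
  rw [← hlamdef] at hlamle
  have hcone : ∀ ω ∈ good, IsEstimator 𝓖 X (X *ᵥ βs.ofLp + fun i => ε i ω) lam (βhat ω) →
      Psi 𝓖 (proj (expandedSupp 𝓖 βs)ᶜ (βhat ω - βs)) ≤
        (cBar c₀ - 1) * Psi 𝓖 (proj (expandedSupp 𝓖 βs) (βhat ω - βs)) := fun ω hω hest =>
    Psi_compl_le_of_excess_le hn hp0 𝓖 X βs _ _ hc₀ hlam
      (mul_le_mul_of_nonneg_left hω (by linarith)) hest.excess_le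
  have hnull : μ.real {ω | ¬ IsEstimator 𝓖 X (X *ᵥ βs.ofLp + fun i => ε i ω) lam (βhat ω)} = 0 := by
    rw [measureReal_def, ae_iff.1 hβhat, ENNReal.toReal_zero]
  have hconclude : ∀ B : Set S, μ.real B ≤ Real.exp (-((n : ℝ) * rate n p ^ 2)) →
      (∀ ω ∈ good, ω ∉ B → IsEstimator 𝓖 X (X *ᵥ βs.ofLp + fun i => ε i ω) lam (βhat ω) →
        ‖βhat ω - βs‖ ≤ R) →
      1 - Real.exp (-((n : ℝ) * rate n p ^ 2)) - α₀ ≤ μ.real {s | ‖βhat s - βs‖ ≤ R} := by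
    intro B hB hgoal
    have hsub : good ⊆ {s | ‖βhat s - βs‖ ≤ R} ∪ (B ∪
        {ω | ¬ IsEstimator 𝓖 X (X *ᵥ βs.ofLp + fun i => ε i ω) lam (βhat ω)}) := by
      intro ω hω
      by_cases h1 : ω ∈ B
      · exact Or.inr (Or.inl h1)
      by_cases h2 : IsEstimator 𝓖 X (X *ᵥ βs.ofLp + fun i => ε i ω) lam (βhat ω)
      · exact Or.inl (hgoal ω hω h1 h2)
      · exact Or.inr (Or.inr h2)
    have h1 := (measureReal_mono (μ := μ) hsub).trans (measureReal_union_le _ _)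
    have h2 := measureReal_union_le (μ := μ) B
      {ω | ¬ IsEstimator 𝓖 X (X *ᵥ βs.ofLp + fun i => ε i ω) lam (βhat ω)}
    linarith
  -- If `c_{|Ω|} = 0`, then `R = 0` and no sphere argument is available, but the cone contains only
  -- the zero vector.
  rcases hcΩ.eq_or_lt with hΩ | hΩ
  · refine hconclude ∅ (by simpa using (Real.exp_pos _).le) fun ω hω _ hest => ?_
    have h := Psi_le_of_cone 𝓖 βs _ hc₀ (hcone ω hω hest)
    rw [← hΩ, zero_mul, mul_zero] at h
    rw [eq_zero_of_Psi_eq_zero 𝓖 (le_antisymm h (Psi_nonneg 𝓖 _)), norm_zero]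
    exact hR0
  · have hc₀' : 0 < c₀ := by linarith
    have hcBar' : 0 < cBar c₀ := by linarith
    have hR : 0 < R := by positivity
    have hρ : 0 < ρ := by positivity
    refine hconclude bad ?_ fun ω hω hωbad hest => ?_
    · have h := measure_deviation_le μ ε hn hp0 hεmeas hεindep X hb₁ hXbdd
        (coneSphere 𝓖 βs c₀ R) hρ (fun γ hγ => sum_abs_le_of_mem_coneSphere hp0 𝓖 βs hc₀ hγ)
        (T := 18 * b₁ * ρ * rate n p) (by positivity)
      exact (ENNReal.toReal_le_of_le_ofReal (by positivity) h).trans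
        (two_mul_exp_le hn0 hp2 hρ hb₁)
    · by_contra hlt
      obtain ⟨δ, hδ, hδle⟩ := exists_mem_coneSphere_of_lt hn 𝓖 X βs (βhat ω - βs)
        (fun i => ε i ω) hlam.le hR0 hest.excess_le (hcone ω hω hest) (not_le.1 hlt)
      refine hωbad ⟨δ, hδ, ?_⟩
      have hmean := le_meanExcess μ ε hn hp0 hεmeas 𝓖 X hXcent hXbdd hb₁ hb₂ hb₃ hc₀ hR βs hRE
        fstar hζdens (fun z hz => hfstar z (hz.trans (le_of_eq ?_))) hδ
      -- In units of `b₁ ρ 𝓔` the mean excess is at least `68 c₀` and the excess at most `7 c₀`. The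
      -- gap `61 c₀` exceeds 18 because `c₀ > 1`.
      · have e1 : b₃ * (2 * b₂ * R ^ 2) = 68 * c₀ * (b₁ * ρ * rate n p) := by
          have : b₂ * b₃ * R = 34 * b₁ * c₀ * cBar c₀ * cOmega 𝓖 βs * cP 𝓖 * rate n p := by
            rw [hRdef]; field_simp
          calc b₃ * (2 * b₂ * R ^ 2) = 2 * (b₂ * b₃ * R) * R := by ring
            _ = _ := by rw [this, hρdef]; ring
        have e2 : lam * (cOmega 𝓖 βs * R) ≤ 7 * c₀ * (b₁ * ρ * rate n p) := by
          have hsq := sqrt_le_rate (n := n) (p := p) (by linarith)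
          calc lam * (cOmega 𝓖 βs * R)
              ≤ c₀ * (cP 𝓖 * (7 * b₁ * rate n p)) * (cOmega 𝓖 βs * R) := by
                refine mul_le_mul_of_nonneg_right (hlamle.trans ?_) (by positivity)
                gcongr
            _ = 7 * c₀ * (b₁ * (cP 𝓖 * (1 * (cOmega 𝓖 βs * R))) * rate n p) := by ring
            -- The factor 1 is enlarged to `c̄` to reach `ρ`.
            _ ≤ _ := by rw [hρdef]; gcongr; linarith
        have e3 : 0 < b₁ * ρ * rate n p := by positivity
        nlinarith
      -- The row differences are bounded by `2 b₁ ρ`, which for this `R` is exactly the radius on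
      -- which `fstar ≥ b₃` is assumed.
      · rw [hRdef]
        field_simp
        ring
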